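/- **Notation.** $\|\cdot\|_\infty$ is the spectral norm, $\sqrt K$ the positive semidefinite square root. For an invertible kernel matrix $K$ and labels $y=(y_1,\dots,y_N)$ the model complexity is $s_K(y)=y^\dagger K^{-1}y$; for $\lambda>0$ put $s_K^\lambda(y)=y^\dagger(K+\lambda I)^{-1}K(K+\lambda I)^{-1}y$ and let $e_K^\lambda(y)=\frac1N\|K(K+\lambda I)^{-1}y-y\|_2^2$ be the mean squared training error. Put $$g(K^1\|K^2)=\sqrt{\big\|\sqrt{K^2}(K^1)^{-1}\sqrt{K^2}\big\|_\infty},$$ $$g_{\mathrm{gen}}^\lambda(K^1\|K^2)=\sqrt{\big\|\sqrt{K^2}\sqrt{K^1}(K^1+\lambda I)^{-2}\sqrt{K^1}\sqrt{K^2}\big\|_\infty},\qquad g_{\mathrm{tra}}^\lambda(K^1\|K^2)=\lambda\sqrt{\big\|\sqrt{K^2}(K^1+\lambda I)^{-2}\sqrt{K^2}\big\|_\infty}.$$ **1. Geometric inequality.** Let $K^1,K^2$ be real or complex Hermitian positive definite $N\times N$ matrices (in particular with $\mathrm{Tr}K^1=\mathrm{Tr}K^2=N$), and $g_{12}=g(K^1\|K^2)$.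 Then $s_{K^1}(y)\le g_{12}^2\,s_{K^2}(y)$ for every labelling $y$, and hence $c\sqrt{s_{K^1}(y)/N}\le c\,g_{12}\sqrt{s_{K^2}(y)/N}$ for every $c\ge0$. If $K^2$ is only positive semidefinite, then for every $y$ in the range of $K^2$ the limit $s_{K^2}(y):=\lim_{\lambda\to0^+}s_{K^2}^\lambda(y)$ exists and again $s_{K^1}(y)\le g_{12}^2\,s_{K^2}(y)$. **2. Prediction error.** Let $\mathcal D$ be a probability distribution of inputs, $x\mapsto\rho(x)=|\psi(x)\rangle\langle\psi(x)|$ a measurable encoding into pure states on a finite-dimensional space, $O$ Hermitian with $\|O\|_\infty\le1$, $U$ unitary, and $q(x)=\mathrm{Tr}(U^\dagger OU\rho(x))$. Let $k(x,x')=\langle\phi(x),\phi(x')\rangle$ be a measurable real kernel given by a feature map into a real inner product space. Draw $x_1,\dots,x_N$ ($N\ge1$) independently from $\mathcal D$, rescale $k$ by a positive constant (depending on the sample) so that $K_{ij}=k(x_i,x_j)$ has trace $N$ (if all $k(x_i,x_i)$ vanish, the rescaled kernel is $0$), and for $\lambda\ge0$ let $$f_\lambda(x)=\min\Big(1,\max\Big(-1,\sum_{i,j}k(x_i,x)\,\big((K+\lambda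 I)^{-1}\big)_{ij}\,q(x_j)\Big)\Big).$$ Let $K^{\mathrm Q}_{ij}=\mathrm{Tr}(\rho(x_i)\rho(x_j))$ and $d=\dim\mathrm{span}_{\mathbb R}\{\rho(x_1),\dots,\rho(x_N)\}$. For every $\delta_0<1$ there is a constant $C$, depending only on $\delta_0$ (so $C$ is absolute for, say, $\delta\le 1/2$), such that for all such data and all $0<\delta\le\delta_0$, with probability at least $1-\delta$ over the sample: if $K$ is invertible, then with $g=g(K\|K^{\mathrm Q})$ $$\mathbb E_{x\sim\mathcal D}|f_0(x)-q(x)|\le C\Big(g\sqrt{\tfrac{\min(d,\mathrm{Tr}(O^2))}{N}}+\sqrt{\tfrac{\log(1/\delta)}{N}}\Big).$$ **3. Regularised version.** Let $\lambda>0$, $K^1$ positive semidefinite and $K^2$ positive definite. For every labelling $y$, $$s_{K^1}^\lambda(y)\le g_{\mathrm{gen}}^\lambda(K^1\|K^2)^2\,s_{K^2}(y),\qquad e_{K^1}^\lambda(y)\le g_{\mathrm{tra}}^\lambda(K^1\|K^2)^2\,s_{K^2}(y),$$ and if $K^1$ is positive definite the formulas at $\lambda=0$ give $g_{\mathrm{gen}}^0=g$,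 $g_{\mathrm{tra}}^0=0$. More generally, let $\phi_1,\phi_2$ be feature maps into real inner product spaces, with arbitrary (possibly singular) kernel matrices $K^{(1)},K^{(2)}$ on inputs $x_1,\dots,x_N$, and let $w$ be a vector in the feature space of $\phi_1$. The functional $v\mapsto\lambda\|v\|^2+\sum_i(\langle v,\phi_2(x_i)\rangle-\langle w,\phi_1(x_i)\rangle)^2$ is minimised by $v=\sum_{i,j}((K^{(2)}+\lambda I)^{-1})_{ij}\langle w,\phi_1(x_j)\rangle\,\phi_2(x_i)$, and every minimiser $v$ satisfies $$\|v\|^2\le g_{\mathrm{gen}}^\lambda(K^{(2)}\|K^{(1)})^2\|w\|^2,\qquad \frac1N\sum_i\big(\langle v,\phi_2(x_i)\rangle-\langle w,\phi_1(x_i)\rangle\big)^2\le g_{\mathrm{tra}}^\lambda(K^{(2)}\|K^{(1)})^2\|w\|^2.$$ Moreover, in the setting of part 2 and with a constant $C$ of the same kind, for each fixed $\lambda>0$ and all $0<\delta\le\delta_0$, with probability at least $1-\delta$ (with no invertibility condition on $K$), $$\mathbb E_{x\sim\mathcal D}|f_\lambda(x)-q(x)|\le C\Big(\big(g_{\mathrm{tra}}^\lambda(K\|K^{\mathrm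 Q})+g_{\mathrm{gen}}^\lambda(K\|K^{\mathrm Q})\big)\sqrt{\tfrac{\min(d,\mathrm{Tr}(O^2))}{N}}+\sqrt{\tfrac{\log(1/\delta)}{N}}\Big).$$ -/

import Mathlib

open Matrix MeasureTheory Filter Topology
open scoped Matrix.Norms.L2Operator InnerProductSpace ComplexOrder

noncomputable section

namespace KernelML

section Geometry

variable {𝕜 : Type*} [RCLike 𝕜] {ι : Type*} [Fintype ι] [DecidableEq ι]

/-- The positive semidefinite square root of a positive semidefinite matrix,
by functional calculus. -/
def matSqrt (K : Matrix ι ι 𝕜) : Matrix ι ι 𝕜 := cfc Real.sqrt K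

/-- The regularised matrix `K + l I`. -/
def ridge (K : Matrix ι ι 𝕜) (l : ℝ) : Matrix ι ι 𝕜 := K + l • (1 : Matrix ι ι 𝕜)

/-- The model complexity `s_K = y† K⁻¹ y` of a labelling `y` (meaningful for invertible `K`). -/
def modelComplexity (K : Matrix ι ι 𝕜) (y : ι → 𝕜) : ℝ :=
  RCLike.re (star y ⬝ᵥ (K⁻¹ *ᵥ y))

/-- The model complexity under regularisation, `y† (K + l I)⁻¹ K (K + l I)⁻¹ y`. -/
def modelComplexityReg (K : Matrix ι ι 𝕜) (l : ℝ) (y : ι → 𝕜) : ℝ :=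
  RCLike.re (star y ⬝ᵥ (((ridge K l)⁻¹ * K * (ridge K l)⁻¹) *ᵥ y))

/-- The mean squared training error of kernel ridge regression with kernel matrix `K`: the fitted
values at the training inputs are `K (K + l I)⁻¹ y`. -/
def trainingError (K : Matrix ι ι 𝕜) (l : ℝ) (y : ι → 𝕜) : ℝ :=
  1 / (Fintype.card ι : ℝ) * ∑ i, ‖(K *ᵥ ((ridge K l)⁻¹ *ᵥ y)) i - y i‖ ^ 2

/-- The geometric difference `g(K₁ ‖ K₂) = √‖√K₂ K₁⁻¹ √K₂‖`, with the spectral norm. -/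
def geomDiff (K₁ K₂ : Matrix ι ι 𝕜) : ℝ :=
  Real.sqrt ‖matSqrt K₂ * K₁⁻¹ * matSqrt K₂‖

/-- The regularised geometric difference
`g_gen = √‖√K₂ √K₁ (K₁ + l I)⁻² √K₁ √K₂‖`; the learner uses `K₁`, the reference is `K₂`. -/
def geomDiffGen (K₁ K₂ : Matrix ι ι 𝕜) (l : ℝ) : ℝ :=
  Real.sqrt ‖matSqrt K₂ * matSqrt K₁ * ((ridge K₁ l)⁻¹ * (ridge K₁ l)⁻¹)
    * matSqrt K₁ * matSqrt K₂‖

/-- The training-error coefficient `g_tra = l √‖√K₂ (K₁ + l I)⁻² √K₂‖`. -/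
def geomDiffTra (K₁ K₂ : Matrix ι ι 𝕜) (l : ℝ) : ℝ :=
  l * Real.sqrt ‖matSqrt K₂ * ((ridge K₁ l)⁻¹ * (ridge K₁ l)⁻¹) * matSqrt K₂‖

end Geometry

section Models

variable {X : Type*} {H : Type*} [NormedAddCommGroup H] [InnerProductSpace ℝ H] {N : ℕ}

/-- The kernel matrix `K i j = ⟪φ (x i), φ (x j)⟫` of the training inputs. -/
def kernelMatrix (φ : X → H) (x : Fin N → X) : Matrix (Fin N) (Fin N) ℝ :=
  Matrix.of fun i j => ⟪φ (x i), φ (x j)⟫_ℝ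

/-- The feature map rescaled by a positive constant so that the kernel matrix on the training
inputs `x` gets trace `N`, that is, `k` becomes `(N / ∑ i, k (x i) (x i)) k`. -/
def rescale (φ : X → H) (x : Fin N → X) : X → H :=
  fun z => Real.sqrt ((N : ℝ) / (kernelMatrix φ x).trace) • φ z

/-- The regularised least-squares training loss
`l ⟪w, w⟫ + ∑ i, (⟪w, φ (x i)⟫ - y i) ^ 2`. -/
def ridgeLoss (φ : X → H) (l : ℝ) (x : Fin N → X) (y : Fin N → ℝ) (w : H) : ℝ :=
  l * ⟪w, w⟫_ℝ + ∑ i, (⟪w, φ (x i)⟫_ℝ - y i) ^ 2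

/-- The trained weight `w = ∑ i j, ((K + l I)⁻¹) i j * y j • φ (x i)`. -/
def trainedWeight (φ : X → H) (l : ℝ) (x : Fin N → X) (y : Fin N → ℝ) : H :=
  ∑ i, ∑ j, ((ridge (kernelMatrix φ x) l)⁻¹ i j * y j) • φ (x i)

/-- The prediction of the trained model: `⟪w, φ z⟫`, confined to `[-1, 1]`. -/
def prediction (φ : X → H) (l : ℝ) (x : Fin N → X) (y : Fin N → ℝ) (z : X) : ℝ :=
  min 1 (max (-1) ⟪trainedWeight φ l x y, φ z⟫_ℝ)

end Models

section Quantum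

variable {m : ℕ}

/-- The density matrix `|ψ⟩⟨ψ|`. -/
def pureState (ψ : EuclideanSpace ℂ (Fin m)) : Matrix (Fin m) (Fin m) ℂ :=
  Matrix.of fun a b => ψ a * star (ψ b)

/-- The quantum model `Tr (U† O U ρ)` evaluated at `ρ = |ψ⟩⟨ψ|`. -/
def quantumModel (O U : Matrix (Fin m) (Fin m) ℂ) (ψ : EuclideanSpace ℂ (Fin m)) : ℝ :=
  (Uᴴ * O * U * pureState ψ).trace.re

variable {X : Type*} {N : ℕ}

/-- The quantum kernel matrix `K i j = Tr (ρ (x i) ρ (x j))`. -/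
def quantumKernelMatrix (ψ : X → EuclideanSpace ℂ (Fin m)) (x : Fin N → X) :
    Matrix (Fin N) (Fin N) ℝ :=
  Matrix.of fun i j => (pureState (ψ (x i)) * pureState (ψ (x j))).trace.re

/-- The dimension `d` of the real span of the training states `ρ (x 1), …, ρ (x N)`. -/
def trainingDim (ψ : X → EuclideanSpace ℂ (Fin m)) (x : Fin N → X) : ℕ :=
  Module.finrank ℝ (Submodule.span ℝ (Set.range fun i => pureState (ψ (x i))))

/-- The average prediction error `𝔼_z |f z - Tr (U† O U ρ z)|` under the data distribution `D` of
the model trained, with regularisation `l`, on the inputs `x` labelled by the quantum model. -/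
def predictionError {H : Type*} [NormedAddCommGroup H] [InnerProductSpace ℝ H]
    [MeasurableSpace X] (D : Measure X) (O U : Matrix (Fin m) (Fin m) ℂ)
    (ψ : X → EuclideanSpace ℂ (Fin m)) (φ : X → H) (l : ℝ) (x : Fin N → X) : ℝ :=
  ∫ z, |prediction φ l x (fun i => quantumModel O U (ψ (x i))) z - quantumModel O U (ψ z)| ∂D

end Quantum

end KernelML

end

/-! The matrix inequalities share one mechanism. A labelling in the range of `K₂` is `y = K₂ c = √K₂
(√K₂ c)`, so the quadratic form of any `M` at `y` is that of `√K₂ M √K₂` at `√K₂ c`, hence at most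
`‖√K₂ M √K₂‖ · c† K₂ c` (`re_quadraticForm_le`). Taking for `M` the matrices `K₁⁻¹`, `(K₁ + l)⁻¹ K₁
(K₁ + l)⁻¹` and `l² (K₁ + l)⁻²` gives `g²`, `g_gen²` and `g_tra²`. No inverse of `K₂` occurs, so
singular references are covered. Labels `⟪w, φ₁ (x i)⟫` see only the projection of `w` onto the span
of the training features, so they are `K c` with `c† K c ≤ ‖w‖²` (`exists_mulVec_kernelMatrix_eq`).

For the quantum model, `w` is the Hilbert–Schmidt projection `B` of `A = U† O U` onto the real span
of the training states. Then `‖B‖² = Tr (A B) ≤ √d ‖B‖`, because `B` has rank at most `d` and `‖A‖ ≤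
1`; also `‖B‖² ≤ ‖A‖² = Tr O²` (`exists_representer`). So the trained weight has norm at most `g_gen
√min(d, Tr O²)`, and Cauchy–Schwarz bounds the summed training error by `√N g_tra √min(d, Tr O²)`.

It remains to bound the generalisation gap by the norm of the trained weight
(`measure_generalisation_gap_le`). Features may be unbounded, and both the radius and the scale of
the kernel depend on the sample. A ghost sample and random swaps of the pairs reduce the claim to
counting on a Boolean cube with all points fixed; only `2 ^ N` weights then occur. At a fixed
radius, contraction, the Rademacher complexity of a ball and McDiarmid's inequality suffice; a union
bound over levels of the radius handles the dependence on the sample (`card_deviation_le`).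

The penalty must involve the feature norms of the selected half only, although the other half could
be much larger. The few pairs with the largest norms are therefore dropped, at bounded cost because
the loss is at most 2; of what remains, a random selection carries a fixed fraction with high
probability (`card_swap_deviation_le`). -/

namespace KernelML

/-! ### Quadratic forms, square roots and regularised inverses of matrices -/

section MatrixInequalities

set_option linter.unusedSectionVars false

variable {𝕜 : Type*} [RCLike 𝕜] {ι : Type*} [Fintype ι] [DecidableEq ι]

lemma matSqrt_mul_self {K : Matrix ι ι 𝕜} (h : K.PosSemidef) : matSqrt K * matSqrt K = K := by
  have hs : ∀ x ∈ spectrum ℝ K, 0 ≤ x := by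
    rw [h.1.spectrum_real_eq_range_eigenvalues]
    rintro _ ⟨i, rfl⟩
    exact h.eigenvalues_nonneg i
  unfold matSqrt
  rw [← cfc_mul Real.sqrt Real.sqrt K]
  conv_rhs => rw [← cfc_id ℝ K h.1]
  exact cfc_congr fun x hx => Real.mul_self_sqrt (hs x hx)

lemma matSqrt_isHermitian (K : Matrix ι ι 𝕜) : (matSqrt K).IsHermitian :=
  cfc_predicate Real.sqrt K

lemma matSqrt_mulVec_matSqrt_mulVec {K : Matrix ι ι 𝕜} (h : K.PosSemidef) (z : ι → 𝕜) :
    matSqrt K *ᵥ (matSqrt K *ᵥ z) = K *ᵥ z := by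
  rw [mulVec_mulVec, matSqrt_mul_self h]

lemma commute_matSqrt (K : Matrix ι ι 𝕜) : Commute (matSqrt K) K :=
  (Commute.refl K).cfc_real Real.sqrt

lemma ridge_zero (K : Matrix ι ι 𝕜) : ridge K 0 = K := by simp [ridge]

lemma ridge_posDef {K : Matrix ι ι 𝕜} (h : K.PosSemidef) {l : ℝ} (hl : 0 < l) :
    (ridge K l).PosDef :=
  Matrix.PosDef.posSemidef_add h (Matrix.PosDef.one.smul hl)

lemma ridge_isHermitian {K : Matrix ι ι 𝕜} (h : K.IsHermitian) (l : ℝ) :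
    (ridge K l).IsHermitian := by
  have h1 : (l • (1 : Matrix ι ι 𝕜)).IsHermitian := by
    rw [Matrix.IsHermitian, Matrix.conjTranspose_smul]; simp
  exact h.add h1

lemma isUnit_det_of_posDef {K : Matrix ι ι 𝕜} (h : K.PosDef) : IsUnit K.det :=
  (Matrix.isUnit_iff_isUnit_det _).1 h.isUnit

lemma commute_inv_of_commute {A B : Matrix ι ι 𝕜} (h : Commute A B) (hB : IsUnit B.det) :
    Commute A B⁻¹ := by
  have h1 : B⁻¹ * (A * B) * B⁻¹ = B⁻¹ * (B * A) * B⁻¹ := by rw [h.eq]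
  rw [← Matrix.mul_assoc, Matrix.nonsing_inv_mul_cancel_left _ _ hB,
    Matrix.mul_nonsing_inv_cancel_right _ _ hB] at h1
  exact h1.symm

/-- All factors commute, being functions of `K`. This links the expression defining `g_gen` to the
quadratic form giving the squared norm of the trained weight. -/
lemma matSqrt_mul_inv_ridge_sq_mul_matSqrt {K : Matrix ι ι 𝕜} (h : K.PosSemidef) {l : ℝ}
    (hu : IsUnit (ridge K l).det) :
    matSqrt K * ((ridge K l)⁻¹ * (ridge K l)⁻¹) * matSqrt K
      = (ridge K l)⁻¹ * K * (ridge K l)⁻¹ := by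
  have hc : Commute (matSqrt K) (ridge K l) :=
    (commute_matSqrt K).add_right ((Commute.one_right _).smul_right l)
  have hi := (commute_inv_of_commute hc hu).eq
  calc _ = (matSqrt K * (ridge K l)⁻¹) * ((ridge K l)⁻¹ * matSqrt K) := by
        simp only [Matrix.mul_assoc]
    _ = ((ridge K l)⁻¹ * matSqrt K) * (matSqrt K * (ridge K l)⁻¹) := by rw [hi]
    _ = (ridge K l)⁻¹ * (matSqrt K * matSqrt K) * (ridge K l)⁻¹ := by
        simp only [Matrix.mul_assoc]
    _ = _ := by rw [matSqrt_mul_self h]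

lemma re_star_dotProduct_self (u : ι → 𝕜) : RCLike.re (star u ⬝ᵥ u) = ∑ i, ‖u i‖ ^ 2 := by
  simp only [dotProduct, map_sum, Pi.star_apply]
  refine Finset.sum_congr rfl fun i _ => ?_
  rw [RCLike.star_def, RCLike.conj_mul]
  norm_cast

lemma re_star_dotProduct_mulVec_le (M : Matrix ι ι 𝕜) (u : ι → 𝕜) :
    RCLike.re (star u ⬝ᵥ M *ᵥ u) ≤ ‖M‖ * RCLike.re (star u ⬝ᵥ u) := by
  set x : EuclideanSpace 𝕜 ι := WithLp.toLp 2 u with hx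
  set z : EuclideanSpace 𝕜 ι := WithLp.toLp 2 (M *ᵥ u) with hz
  have h1 : star u ⬝ᵥ M *ᵥ u = inner 𝕜 x z := by
    rw [EuclideanSpace.inner_eq_star_dotProduct, dotProduct_comm]
  have h2 : RCLike.re (star u ⬝ᵥ u) = ‖x‖ ^ 2 := by
    rw [re_star_dotProduct_self, EuclideanSpace.norm_sq_eq]
  have h3 : ‖z‖ ≤ ‖M‖ * ‖x‖ := Matrix.l2_opNorm_mulVec M x
  rw [h1, h2]
  calc _ ≤ ‖x‖ * ‖z‖ := re_inner_le_norm x z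
    _ ≤ ‖x‖ * (‖M‖ * ‖x‖) := by gcongr
    _ = _ := by ring

lemma star_mulVec_dotProduct_of_isHermitian {S : Matrix ι ι 𝕜} (hS : S.IsHermitian)
    (u v : ι → 𝕜) : star (S *ᵥ u) ⬝ᵥ v = star u ⬝ᵥ S *ᵥ v := by
  rw [star_mulVec, hS.eq, dotProduct_mulVec]

/-- For `y = K c` the quadratic form of `M` at `y` is controlled by `‖√K M √K‖` and `c† K c`. -/
lemma re_quadraticForm_le {K : Matrix ι ι 𝕜} (h : K.PosSemidef) (M : Matrix ι ι 𝕜) (c : ι → 𝕜) :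
    RCLike.re (star (K *ᵥ c) ⬝ᵥ M *ᵥ (K *ᵥ c))
      ≤ ‖matSqrt K * M * matSqrt K‖ * RCLike.re (star c ⬝ᵥ K *ᵥ c) := by
  have hS := matSqrt_isHermitian K
  have hK : K *ᵥ c = matSqrt K *ᵥ (matSqrt K *ᵥ c) := by
    rw [mulVec_mulVec, matSqrt_mul_self h]
  have h1 := re_star_dotProduct_mulVec_le (matSqrt K * M * matSqrt K) (matSqrt K *ᵥ c)
  rw [star_mulVec_dotProduct_of_isHermitian hS c (matSqrt K *ᵥ c), ← hK] at h1
  refine le_trans (le_of_eq ?_) h1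
  conv_lhs => rw [hK]
  rw [star_mulVec_dotProduct_of_isHermitian hS]
  simp only [mulVec_mulVec, Matrix.mul_assoc]

lemma modelComplexity_mulVec {K : Matrix ι ι 𝕜} (h : K.PosDef) (c : ι → 𝕜) :
    modelComplexity K (K *ᵥ c) = RCLike.re (star c ⬝ᵥ K *ᵥ c) := by
  rw [modelComplexity, star_mulVec_dotProduct_of_isHermitian h.1, mulVec_mulVec,
    mulVec_mulVec, Matrix.mul_nonsing_inv _ (isUnit_det_of_posDef h), Matrix.one_mul]

lemma exists_mulVec_eq {K : Matrix ι ι 𝕜} (h : K.PosDef) (y : ι → 𝕜) : ∃ c, K *ᵥ c = y :=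
  ⟨K⁻¹ *ᵥ y, by rw [mulVec_mulVec, Matrix.mul_nonsing_inv _ (isUnit_det_of_posDef h), one_mulVec]⟩

lemma geomDiff_sq (K₁ K₂ : Matrix ι ι 𝕜) :
    geomDiff K₁ K₂ ^ 2 = ‖matSqrt K₂ * K₁⁻¹ * matSqrt K₂‖ :=
  Real.sq_sqrt (norm_nonneg _)

lemma geomDiffGen_sq {K₁ : Matrix ι ι 𝕜} (h₁ : K₁.PosSemidef) (K₂ : Matrix ι ι 𝕜) {l : ℝ}
    (hu : IsUnit (ridge K₁ l).det) :
    geomDiffGen K₁ K₂ l ^ 2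
      = ‖matSqrt K₂ * ((ridge K₁ l)⁻¹ * K₁ * (ridge K₁ l)⁻¹) * matSqrt K₂‖ := by
  rw [geomDiffGen, Real.sq_sqrt (norm_nonneg _), ← matSqrt_mul_inv_ridge_sq_mul_matSqrt h₁ hu]
  simp only [Matrix.mul_assoc]

lemma geomDiffTra_sq (K₁ K₂ : Matrix ι ι 𝕜) (l : ℝ) :
    geomDiffTra K₁ K₂ l ^ 2
      = l ^ 2 * ‖matSqrt K₂ * ((ridge K₁ l)⁻¹ * (ridge K₁ l)⁻¹) * matSqrt K₂‖ := by
  rw [geomDiffTra, mul_pow, Real.sq_sqrt (norm_nonneg _)]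

/-- Here `c† K₂ c` stands in for the complexity of `K₂ c` under `K₂`, so that `K₂` may be singular.
-/
lemma modelComplexity_mulVec_le {K₁ K₂ : Matrix ι ι 𝕜} (h₂ : K₂.PosSemidef) (c : ι → 𝕜) :
    modelComplexity K₁ (K₂ *ᵥ c) ≤ geomDiff K₁ K₂ ^ 2 * RCLike.re (star c ⬝ᵥ K₂ *ᵥ c) := by
  rw [geomDiff_sq]
  exact re_quadraticForm_le h₂ _ c

lemma modelComplexityReg_mulVec_le {K₁ K₂ : Matrix ι ι 𝕜} (h₁ : K₁.PosSemidef)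
    (h₂ : K₂.PosSemidef) {l : ℝ} (hu : IsUnit (ridge K₁ l).det) (c : ι → 𝕜) :
    modelComplexityReg K₁ l (K₂ *ᵥ c)
      ≤ geomDiffGen K₁ K₂ l ^ 2 * RCLike.re (star c ⬝ᵥ K₂ *ᵥ c) := by
  rw [geomDiffGen_sq h₁ _ hu]
  exact re_quadraticForm_le h₂ _ c

/-- Write `K = (K + l) - l`. The residual is `-l` times the coefficient vector: the source of the
factor `l` in `g_tra` and of the stationarity of the ridge solution. -/
lemma mulVec_inv_ridge_sub {K : Matrix ι ι 𝕜} {l : ℝ} (hu : IsUnit (ridge K l).det)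
    (y : ι → 𝕜) : K *ᵥ ((ridge K l)⁻¹ *ᵥ y) - y = -(l • ((ridge K l)⁻¹ *ᵥ y)) := by
  have h : ridge K l *ᵥ ((ridge K l)⁻¹ *ᵥ y) = y := by
    rw [mulVec_mulVec, Matrix.mul_nonsing_inv _ hu, one_mulVec]
  have h2 : ridge K l *ᵥ ((ridge K l)⁻¹ *ᵥ y)
      = K *ᵥ ((ridge K l)⁻¹ *ᵥ y) + l • ((ridge K l)⁻¹ *ᵥ y) := by
    conv_lhs => rw [show ridge K l = K + l • (1 : Matrix ι ι 𝕜) from rfl]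
    rw [add_mulVec, smul_mulVec, one_mulVec]; rfl
  rw [h] at h2
  rw [eq_neg_iff_add_eq_zero]
  nth_rewrite 2 [h2]
  abel

lemma sum_residual_sq_le {K₁ K₂ : Matrix ι ι 𝕜} (h₁ : K₁.PosSemidef) (h₂ : K₂.PosSemidef) {l : ℝ}
    (hu : IsUnit (ridge K₁ l).det) (c : ι → 𝕜) :
    ∑ i, ‖(K₁ *ᵥ ((ridge K₁ l)⁻¹ *ᵥ (K₂ *ᵥ c))) i - (K₂ *ᵥ c) i‖ ^ 2
      ≤ geomDiffTra K₁ K₂ l ^ 2 * RCLike.re (star c ⬝ᵥ K₂ *ᵥ c) := by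
  rw [geomDiffTra_sq, mul_assoc]
  have hH : ((ridge K₁ l)⁻¹).IsHermitian := (ridge_isHermitian h₁.1 l).inv
  calc _ = ∑ i, l ^ 2 * ‖((ridge K₁ l)⁻¹ *ᵥ (K₂ *ᵥ c)) i‖ ^ 2 := by
        refine Finset.sum_congr rfl fun i _ => ?_
        have := congrFun (mulVec_inv_ridge_sub hu (K₂ *ᵥ c)) i
        rw [Pi.sub_apply] at this
        rw [this, Pi.neg_apply, Pi.smul_apply, norm_neg, norm_smul, mul_pow, Real.norm_eq_abs,
          sq_abs]
    _ = l ^ 2 * RCLike.re (star (K₂ *ᵥ c) ⬝ᵥ ((ridge K₁ l)⁻¹ * (ridge K₁ l)⁻¹) *ᵥ (K₂ *ᵥ c)) := by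
        rw [← Finset.mul_sum, ← re_star_dotProduct_self,
          star_mulVec_dotProduct_of_isHermitian hH, mulVec_mulVec]
    _ ≤ _ := mul_le_mul_of_nonneg_left (re_quadraticForm_le h₂ _ c) (sq_nonneg l)

lemma trainingError_mulVec_le {N : ℕ} {K₁ K₂ : Matrix (Fin N) (Fin N) 𝕜} (h₁ : K₁.PosSemidef)
    (h₂ : K₂.PosSemidef) {l : ℝ} (hu : IsUnit (ridge K₁ l).det) (c : Fin N → 𝕜) :
    trainingError K₁ l (K₂ *ᵥ c)
      ≤ geomDiffTra K₁ K₂ l ^ 2 * RCLike.re (star c ⬝ᵥ K₂ *ᵥ c) := by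
  refine le_trans ?_ (sum_residual_sq_le h₁ h₂ hu c)
  rw [trainingError, Fintype.card_fin]
  -- The bound already holds for the sum of squares; the factor `1 / N ≤ 1` is simply discarded, and
  -- `N = 0` is harmless.
  exact mul_le_of_le_one_left (Finset.sum_nonneg fun _ _ => by positivity)
    (by rw [one_div]; exact Nat.cast_inv_le_one N)

lemma geomDiffGen_zero {K₁ : Matrix ι ι 𝕜} (h₁ : K₁.PosDef) (K₂ : Matrix ι ι 𝕜) :
    geomDiffGen K₁ K₂ 0 = geomDiff K₁ K₂ := by
  have hu : IsUnit (ridge K₁ 0).det := by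
    rw [ridge_zero]; exact isUnit_det_of_posDef h₁
  have h := geomDiffGen_sq h₁.posSemidef K₂ hu
  rw [ridge_zero, Matrix.nonsing_inv_mul _ (isUnit_det_of_posDef h₁), Matrix.one_mul,
    ← geomDiff_sq] at h
  exact (sq_eq_sq₀ (Real.sqrt_nonneg _) (Real.sqrt_nonneg _)).1 h

lemma geomDiffTra_zero (K₁ K₂ : Matrix ι ι 𝕜) : geomDiffTra K₁ K₂ 0 = 0 := by
  simp [geomDiffTra]

/-- The vector `l (K + l)⁻¹ √K c` has squared norm at most `l ‖c‖²`. -/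
lemma sum_norm_smul_inv_ridge_sq_le {K : Matrix ι ι 𝕜} (h : K.PosSemidef) {l : ℝ}
    (hl : 0 < l) (c : ι → 𝕜) :
    ∑ i, ‖(l • ((ridge K l)⁻¹ *ᵥ (matSqrt K *ᵥ c))) i‖ ^ 2 ≤ l * ∑ i, ‖c i‖ ^ 2 := by
  have hu := isUnit_det_of_posDef (ridge_posDef h hl)
  set z := (ridge K l)⁻¹ *ᵥ (matSqrt K *ᵥ c) with hz
  have hS := matSqrt_isHermitian K
  have e1 : K *ᵥ z + l • z = matSqrt K *ᵥ c := by
    have := mulVec_inv_ridge_sub hu (matSqrt K *ᵥ c)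
    rw [← hz, sub_eq_iff_eq_add] at this
    rw [this]; abel
  -- Pairing `(K + l) z = √K c` with `z` gives `‖√K z‖² + l ‖z‖² = Re ⟨√K z, c⟩ ≤ ‖√K z‖² + ‖c‖²`;
  -- the first term cancels, leaving `l ‖z‖² ≤ ‖c‖²`.
  have e2 : RCLike.re (star z ⬝ᵥ K *ᵥ z) + l * RCLike.re (star z ⬝ᵥ z)
      = RCLike.re (star (matSqrt K *ᵥ z) ⬝ᵥ c) := by
    rw [star_mulVec_dotProduct_of_isHermitian hS, ← e1, dotProduct_add, map_add,
      dotProduct_smul, RCLike.smul_re]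
  have e3 : RCLike.re (star z ⬝ᵥ K *ᵥ z) = ∑ i, ‖(matSqrt K *ᵥ z) i‖ ^ 2 := by
    rw [← re_star_dotProduct_self, star_mulVec_dotProduct_of_isHermitian hS,
      matSqrt_mulVec_matSqrt_mulVec h]
  have e4 : RCLike.re (star (matSqrt K *ᵥ z) ⬝ᵥ c)
      ≤ ∑ i, (‖(matSqrt K *ᵥ z) i‖ ^ 2 + ‖c i‖ ^ 2) := by
    rw [dotProduct, map_sum]
    refine Finset.sum_le_sum fun i _ => ?_
    refine (RCLike.re_le_norm _).trans ?_
    rw [norm_mul, Pi.star_apply, norm_star]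
    nlinarith [sq_nonneg (‖(matSqrt K *ᵥ z) i‖ - ‖c i‖), norm_nonneg ((matSqrt K *ᵥ z) i),
      norm_nonneg (c i)]
  rw [Finset.sum_add_distrib, ← e2, e3, re_star_dotProduct_self] at e4
  have e5 : l * ∑ i, ‖z i‖ ^ 2 ≤ ∑ i, ‖c i‖ ^ 2 := by linarith
  calc _ = l * (l * ∑ i, ‖z i‖ ^ 2) := by
        rw [Finset.mul_sum, Finset.mul_sum]
        refine Finset.sum_congr rfl fun i _ => ?_
        rw [Pi.smul_apply, norm_smul, mul_pow, Real.norm_eq_abs, sq_abs]; ring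
    _ ≤ _ := by gcongr

/-- The complexity of a labelling in the range of `K` under vanishing regularisation. -/
lemma tendsto_modelComplexityReg {K : Matrix ι ι 𝕜} (h : K.PosSemidef) (c : ι → 𝕜) :
    Tendsto (fun l : ℝ => modelComplexityReg K l (K *ᵥ c)) (𝓝[>] 0)
      (𝓝 (RCLike.re (star c ⬝ᵥ K *ᵥ c))) := by
  have hS := matSqrt_isHermitian K
  set p := matSqrt K *ᵥ c with hp
  -- With `p = √K c` the regularised complexity is `‖p - l (K + l)⁻¹ p‖²`. The correction has
  -- squared norm at most `l ‖c‖²`, so it vanishes in the limit and `‖p‖² = c† K c` is left.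
  have key : ∀ l : ℝ, 0 < l → modelComplexityReg K l (K *ᵥ c)
      = RCLike.re (star (p - l • ((ridge K l)⁻¹ *ᵥ p)) ⬝ᵥ (p - l • ((ridge K l)⁻¹ *ᵥ p))) := by
    intro l hl
    have hu := isUnit_det_of_posDef (ridge_posDef h hl)
    have hH : ((ridge K l)⁻¹).IsHermitian := (ridge_isHermitian h.1 l).inv
    have hc : Commute (matSqrt K) (ridge K l)⁻¹ := commute_inv_of_commute
      ((commute_matSqrt K).add_right ((Commute.one_right _).smul_right l)) hu
    have e : p - l • ((ridge K l)⁻¹ *ᵥ p) = matSqrt K *ᵥ ((ridge K l)⁻¹ *ᵥ (K *ᵥ c)) := by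
      have h1 := mulVec_inv_ridge_sub hu p
      rw [sub_eq_iff_eq_add] at h1
      have h2 : p - l • ((ridge K l)⁻¹ *ᵥ p) = K *ᵥ ((ridge K l)⁻¹ *ᵥ p) := by
        rw [h1]; abel
      rw [h2, hp]
      have hK : Commute K (ridge K l)⁻¹ := commute_inv_of_commute
        ((Commute.refl K).add_right ((Commute.one_right _).smul_right l)) hu
      simp only [mulVec_mulVec]
      congr 1
      rw [← hK.eq, ← hc.eq, ← Matrix.mul_assoc, ← Matrix.mul_assoc, (commute_matSqrt K).eq]
    rw [e, star_mulVec_dotProduct_of_isHermitian hS, matSqrt_mulVec_matSqrt_mulVec h,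
      star_mulVec_dotProduct_of_isHermitian hH, modelComplexityReg]
    simp only [mulVec_mulVec, Matrix.mul_assoc]
  have hz : Tendsto (fun l : ℝ => l • ((ridge K l)⁻¹ *ᵥ p)) (𝓝[>] 0) (𝓝 0) := by
    rw [tendsto_pi_nhds]
    intro i
    have hb : ∀ᶠ l : ℝ in 𝓝[>] 0, ‖(l • ((ridge K l)⁻¹ *ᵥ p)) i‖
        ≤ Real.sqrt (l * ∑ i, ‖c i‖ ^ 2) := by
      filter_upwards [self_mem_nhdsWithin] with l hl
      refine Real.le_sqrt_of_sq_le ?_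
      exact (Finset.single_le_sum (f := fun i => ‖(l • ((ridge K l)⁻¹ *ᵥ p)) i‖ ^ 2)
        (fun _ _ => sq_nonneg _) (Finset.mem_univ i)).trans
        (sum_norm_smul_inv_ridge_sq_le h hl c)
    refine squeeze_zero_norm' hb ?_
    have hcont : Continuous fun l : ℝ => Real.sqrt (l * ∑ i, ‖c i‖ ^ 2) := by fun_prop
    have := hcont.tendsto 0
    simp only [zero_mul, Real.sqrt_zero] at this
    exact this.mono_left nhdsWithin_le_nhds
  have hq : Continuous fun v : ι → 𝕜 => RCLike.re (star (p - v) ⬝ᵥ (p - v)) := by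
    simp only [dotProduct]
    fun_prop
  have h0 := (hq.tendsto 0).comp hz
  have e0 : RCLike.re (star (p - 0) ⬝ᵥ (p - 0)) = RCLike.re (star c ⬝ᵥ K *ᵥ c) := by
    rw [sub_zero, hp, star_mulVec_dotProduct_of_isHermitian hS, mulVec_mulVec, matSqrt_mul_self h]
  rw [e0] at h0
  refine h0.congr' ?_
  filter_upwards [self_mem_nhdsWithin] with l hl
  exact (key l hl).symm

end MatrixInequalities

end KernelML

namespace KernelML

/-! ### Kernel ridge regression in a feature space -/

section Ridge

variable {X : Type*} {H : Type*} [NormedAddCommGroup H] [InnerProductSpace ℝ H] {N : ℕ}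

lemma kernelMatrix_posSemidef (φ : X → H) (x : Fin N → X) : (kernelMatrix φ x).PosSemidef :=
  Matrix.posSemidef_gram ℝ fun i => φ (x i)

lemma inner_sum_smul_feature (φ : X → H) (x : Fin N → X) (c : Fin N → ℝ) (i : Fin N) :
    ⟪∑ j, c j • φ (x j), φ (x i)⟫_ℝ = (kernelMatrix φ x *ᵥ c) i := by
  rw [sum_inner, mulVec, dotProduct]
  refine Finset.sum_congr rfl fun j _ => ?_
  rw [real_inner_smul_left, kernelMatrix, Matrix.of_apply, real_inner_comm, mul_comm]

lemma norm_sum_smul_feature_sq (φ : X → H) (x : Fin N → X) (c : Fin N → ℝ) :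
    ‖∑ j, c j • φ (x j)‖ ^ 2 = RCLike.re (star c ⬝ᵥ kernelMatrix φ x *ᵥ c) := by
  rw [← real_inner_self_eq_norm_sq, inner_sum, dotProduct, RCLike.re_to_real]
  refine Finset.sum_congr rfl fun i _ => ?_
  rw [real_inner_smul_right, inner_sum_smul_feature]; simp

/-- Labels represented in a feature space lie in the range of the kernel matrix. -/
lemma exists_mulVec_kernelMatrix_eq (φ : X → H) (x : Fin N → X) (w : H) :
    ∃ c : Fin N → ℝ, (fun i => ⟪w, φ (x i)⟫_ℝ) = kernelMatrix φ x *ᵥ c ∧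
      RCLike.re (star c ⬝ᵥ kernelMatrix φ x *ᵥ c) ≤ ‖w‖ ^ 2 := by
  -- The feature space need not be complete; the finite-dimensional span still admits an orthogonal
  -- projection.
  let S : Submodule ℝ H := Submodule.span ℝ (Set.range fun i => φ (x i))
  have : FiniteDimensional ℝ S := FiniteDimensional.span_of_finite ℝ (Set.finite_range _)
  have hp : S.starProjection w ∈ S := Submodule.starProjection_apply_mem S w
  obtain ⟨c, hc⟩ := (Submodule.mem_span_range_iff_exists_fun ℝ).1 hp
  refine ⟨c, ?_, ?_⟩
  · funext i
    rw [← inner_sum_smul_feature, hc]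
    have h1 : φ (x i) ∈ S := Submodule.subset_span ⟨i, rfl⟩
    have h2 := S.sub_starProjection_mem_orthogonal w (φ (x i)) h1
    rw [inner_sub_right, sub_eq_zero] at h2
    rw [real_inner_comm, h2, real_inner_comm]
  · rw [← norm_sum_smul_feature_sq, hc]
    gcongr
    exact S.norm_starProjection_apply_le w

lemma trainedWeight_eq (φ : X → H) (l : ℝ) (x : Fin N → X) (y : Fin N → ℝ) :
    trainedWeight φ l x y = ∑ i, ((ridge (kernelMatrix φ x) l)⁻¹ *ᵥ y) i • φ (x i) := by
  refine Finset.sum_congr rfl fun i _ => ?_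
  rw [← Finset.sum_smul]; rfl

lemma inner_trainedWeight (φ : X → H) (l : ℝ) (x : Fin N → X) (y : Fin N → ℝ) (i : Fin N) :
    ⟪trainedWeight φ l x y, φ (x i)⟫_ℝ
      = (kernelMatrix φ x *ᵥ ((ridge (kernelMatrix φ x) l)⁻¹ *ᵥ y)) i := by
  rw [trainedWeight_eq, inner_sum_smul_feature]

lemma norm_trainedWeight_sq (φ : X → H) (l : ℝ) (x : Fin N → X) (y : Fin N → ℝ) :
    ‖trainedWeight φ l x y‖ ^ 2 = modelComplexityReg (kernelMatrix φ x) l y := by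
  have hH : ((ridge (kernelMatrix φ x) l)⁻¹).IsHermitian :=
    (ridge_isHermitian (kernelMatrix_posSemidef φ x).1 l).inv
  rw [trainedWeight_eq, norm_sum_smul_feature_sq, modelComplexityReg,
    star_mulVec_dotProduct_of_isHermitian hH]
  simp only [mulVec_mulVec, Matrix.mul_assoc]

/-- The weight trained on labels `⟪w, φ₁ (x i)⟫` has norm at most `g_gen ‖w‖`. -/
lemma norm_trainedWeight_sq_le {H₁ : Type*} [NormedAddCommGroup H₁] [InnerProductSpace ℝ H₁]
    (φ₁ : X → H₁) (φ : X → H) (x : Fin N → X) {l : ℝ} (w : H₁)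
    (hu : IsUnit (ridge (kernelMatrix φ x) l).det) :
    ‖trainedWeight φ l x fun i => ⟪w, φ₁ (x i)⟫_ℝ‖ ^ 2
      ≤ geomDiffGen (kernelMatrix φ x) (kernelMatrix φ₁ x) l ^ 2 * ‖w‖ ^ 2 := by
  obtain ⟨c, hc, hle⟩ := exists_mulVec_kernelMatrix_eq φ₁ x w
  rw [hc, norm_trainedWeight_sq]
  exact (modelComplexityReg_mulVec_le (kernelMatrix_posSemidef φ x)
    (kernelMatrix_posSemidef φ₁ x) hu c).trans (by gcongr)

/-- The training residual on labels `⟪w, φ₁ (x i)⟫` is at most `g_tra ‖w‖`. -/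
lemma sum_residual_trainedWeight_sq_le {H₁ : Type*} [NormedAddCommGroup H₁]
    [InnerProductSpace ℝ H₁] (φ₁ : X → H₁) (φ : X → H) (x : Fin N → X) {l : ℝ} (w : H₁)
    (hu : IsUnit (ridge (kernelMatrix φ x) l).det) :
    ∑ i, (⟪trainedWeight φ l x (fun i => ⟪w, φ₁ (x i)⟫_ℝ), φ (x i)⟫_ℝ - ⟪w, φ₁ (x i)⟫_ℝ) ^ 2
      ≤ geomDiffTra (kernelMatrix φ x) (kernelMatrix φ₁ x) l ^ 2 * ‖w‖ ^ 2 := by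
  obtain ⟨c, hc, hle⟩ := exists_mulVec_kernelMatrix_eq φ₁ x w
  have h := (sum_residual_sq_le (kernelMatrix_posSemidef φ x)
    (kernelMatrix_posSemidef φ₁ x) hu c).trans (mul_le_mul_of_nonneg_left hle (sq_nonneg _))
  refine le_trans (le_of_eq ?_) h
  refine Finset.sum_congr rfl fun i _ => ?_
  rw [inner_trainedWeight, hc, ← congrFun hc i, Real.norm_eq_abs, sq_abs]

/-- The loss is quadratic, so its expansion at the trained weight is exact, and the linear term
`hfoc` vanishes because each residual is `-l` times the corresponding coefficient. Minimality and
uniqueness of the minimiser for `l > 0` follow. -/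
lemma ridgeLoss_eq (φ : X → H) {l : ℝ} (x : Fin N → X) (y : Fin N → ℝ) (v : H)
    (hu : IsUnit (ridge (kernelMatrix φ x) l).det) :
    ridgeLoss φ l x y v = ridgeLoss φ l x y (trainedWeight φ l x y)
      + l * ‖v - trainedWeight φ l x y‖ ^ 2
      + ∑ i, ⟪v - trainedWeight φ l x y, φ (x i)⟫_ℝ ^ 2 := by
  set w := trainedWeight φ l x y with hw
  set h := v - w with hh
  have hv : v = w + h := by rw [hh]; abel
  have hres : ∀ i, ⟪w, φ (x i)⟫_ℝ - y i
      = -(l * ((ridge (kernelMatrix φ x) l)⁻¹ *ᵥ y) i) := fun i => by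
    rw [hw, inner_trainedWeight]
    exact congrFun (mulVec_inv_ridge_sub hu y) i
  have hfoc : l * ⟪w, h⟫_ℝ + ∑ i, (⟪w, φ (x i)⟫_ℝ - y i) * ⟪h, φ (x i)⟫_ℝ = 0 := by
    have hwh : ⟪w, h⟫_ℝ
        = ∑ i, ((ridge (kernelMatrix φ x) l)⁻¹ *ᵥ y) i * ⟪h, φ (x i)⟫_ℝ := by
      rw [hw, trainedWeight_eq, sum_inner]
      exact Finset.sum_congr rfl fun i _ => by rw [real_inner_smul_left, real_inner_comm]
    rw [hwh, Finset.mul_sum, ← Finset.sum_add_distrib]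
    refine Finset.sum_eq_zero fun i _ => ?_
    rw [hres]
    ring
  have e : ∀ i, (⟪v, φ (x i)⟫_ℝ - y i) ^ 2 = (⟪w, φ (x i)⟫_ℝ - y i) ^ 2
      + 2 * ((⟪w, φ (x i)⟫_ℝ - y i) * ⟪h, φ (x i)⟫_ℝ) + ⟪h, φ (x i)⟫_ℝ ^ 2 := fun i => by
    rw [hv, inner_add_left]; ring
  have e2 : ⟪v, v⟫_ℝ = ⟪w, w⟫_ℝ + 2 * ⟪w, h⟫_ℝ + ‖h‖ ^ 2 := by
    rw [hv, real_inner_add_add_self, real_inner_self_eq_norm_sq h]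
  simp only [ridgeLoss]
  rw [e2, Finset.sum_congr rfl fun i _ => e i, Finset.sum_add_distrib, Finset.sum_add_distrib,
    ← Finset.mul_sum]
  linear_combination 2 * hfoc

lemma isMinOn_ridgeLoss_trainedWeight (φ : X → H) {l : ℝ} (hl : 0 < l) (x : Fin N → X)
    (y : Fin N → ℝ) : IsMinOn (ridgeLoss φ l x y) Set.univ (trainedWeight φ l x y) := by
  intro v _
  have h := ridgeLoss_eq φ x y v
    (isUnit_det_of_posDef (ridge_posDef (kernelMatrix_posSemidef φ x) hl))
  have h1 : 0 ≤ ∑ i, ⟪v - trainedWeight φ l x y, φ (x i)⟫_ℝ ^ 2 :=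
    Finset.sum_nonneg fun _ _ => sq_nonneg _
  have h2 : 0 ≤ l * ‖v - trainedWeight φ l x y‖ ^ 2 := by positivity
  change _ ≤ ridgeLoss φ l x y v
  linarith

lemma eq_trainedWeight_of_isMinOn (φ : X → H) {l : ℝ} (hl : 0 < l) (x : Fin N → X)
    (y : Fin N → ℝ) {v : H} (hv : IsMinOn (ridgeLoss φ l x y) Set.univ v) :
    v = trainedWeight φ l x y := by
  have h := ridgeLoss_eq φ x y v
    (isUnit_det_of_posDef (ridge_posDef (kernelMatrix_posSemidef φ x) hl))
  have h0 : ridgeLoss φ l x y v ≤ ridgeLoss φ l x y (trainedWeight φ l x y) :=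
    hv (Set.mem_univ _)
  have h1 : 0 ≤ ∑ i, ⟪v - trainedWeight φ l x y, φ (x i)⟫_ℝ ^ 2 :=
    Finset.sum_nonneg fun _ _ => sq_nonneg _
  have h2 : ‖v - trainedWeight φ l x y‖ ^ 2 ≤ 0 := by
    by_contra hc
    have := mul_pos hl (not_le.1 hc)
    linarith
  have h3 : ‖v - trainedWeight φ l x y‖ = 0 := pow_eq_zero_iff two_ne_zero |>.1
    (le_antisymm h2 (sq_nonneg _))
  exact sub_eq_zero.1 (norm_eq_zero.1 h3)

end Ridge

end KernelML

namespace KernelML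

/-! ### Concentration, contraction and Rademacher averages on the Boolean cube -/

section Cube

lemma sum_cube_succ {n : ℕ} (f : (Fin (n + 1) → Bool) → ℝ) :
    ∑ σ, f σ = ∑ τ : Fin n → Bool, (f (Fin.cons true τ) + f (Fin.cons false τ)) := by
  rw [← (Fin.consEquiv fun _ : Fin (n + 1) => Bool).sum_comp, Fintype.sum_prod_type,
    Fintype.sum_bool, ← Finset.sum_add_distrib]
  rfl

lemma card_cube (n : ℕ) : (Fintype.card (Fin n → Bool) : ℝ) = 2 ^ n := by simp

/-- The Rademacher sign of a Boolean. -/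
def sgn (b : Bool) : ℝ := if b then 1 else -1

@[simp] lemma sgn_true : sgn true = 1 := rfl
@[simp] lemma sgn_false : sgn false = -1 := rfl

/-- Bounded differences on the Boolean cube give a sub-Gaussian exponential moment. -/
lemma sum_exp_le_of_bounded_differences {c : ℝ} (θ : ℝ) : ∀ {n : ℕ} (F : (Fin n → Bool) → ℝ),
    (∀ σ i b, |F σ - F (Function.update σ i b)| ≤ c) →
    ∑ σ, Real.exp (θ * F σ)
      ≤ 2 ^ n * Real.exp (θ * ((∑ σ, F σ) / 2 ^ n) + n * (θ ^ 2 * c ^ 2 / 8))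
  | 0, F, _ => by simp
  | n + 1, F, hF => by
    -- Induction by averaging out the first coordinate: `G` keeps the mean and the bounded
    -- differences, and the two values lost cost a factor `cosh (θ (a - b) / 2) ≤ exp (θ² c² / 8)`.
    set G : (Fin n → Bool) → ℝ :=
      fun τ => (F (Fin.cons true τ) + F (Fin.cons false τ)) / 2 with hG
    have hGd : ∀ σ i b, |G σ - G (Function.update σ i b)| ≤ c := by
      intro σ i b
      have h1 := hF (Fin.cons true σ) i.succ b
      have h2 := hF (Fin.cons false σ) i.succ b
      rw [← Fin.cons_update] at h1 h2
      rw [abs_le] at h1 h2 ⊢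
      simp only [hG]
      constructor <;> linarith [h1.1, h1.2, h2.1, h2.2]
    have ih := sum_exp_le_of_bounded_differences θ G hGd
    have hpt : ∀ τ : Fin n → Bool, Real.exp (θ * F (Fin.cons true τ))
        + Real.exp (θ * F (Fin.cons false τ))
        ≤ 2 * Real.exp (θ ^ 2 * c ^ 2 / 8) * Real.exp (θ * G τ) := by
      intro τ
      set a := F (Fin.cons true τ)
      set b := F (Fin.cons false τ)
      have hab : |a - b| ≤ c := by
        have := hF (Fin.cons true τ) 0 false
        rwa [Fin.update_cons_zero] at this
      have e1 : Real.exp (θ * a) + Real.exp (θ * b)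
          = 2 * Real.cosh (θ * (a - b) / 2) * Real.exp (θ * G τ) := by
        rw [Real.cosh_eq, hG]
        rw [show θ * a = θ * (a - b) / 2 + θ * ((a + b) / 2) by ring,
          show θ * b = -(θ * (a - b) / 2) + θ * ((a + b) / 2) by ring, Real.exp_add, Real.exp_add]
        ring
      rw [e1]
      have h3 : (θ * (a - b) / 2) ^ 2 / 2 ≤ θ ^ 2 * c ^ 2 / 8 := by
        have : (a - b) ^ 2 ≤ c ^ 2 := sq_le_sq' (abs_le.1 hab).1 (abs_le.1 hab).2
        nlinarith [mul_le_mul_of_nonneg_left this (sq_nonneg θ)]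
      have h4 := (Real.cosh_le_exp_half_sq (θ * (a - b) / 2)).trans (Real.exp_le_exp.2 h3)
      gcongr
    have hmean : (∑ σ, F σ) / 2 ^ (n + 1) = (∑ τ, G τ) / 2 ^ n := by
      rw [sum_cube_succ, hG, ← Finset.sum_div, pow_succ]
      field_simp
    rw [sum_cube_succ, hmean]
    calc _ ≤ ∑ τ, 2 * Real.exp (θ ^ 2 * c ^ 2 / 8) * Real.exp (θ * G τ) :=
          Finset.sum_le_sum fun τ _ => hpt τ
      _ ≤ 2 * Real.exp (θ ^ 2 * c ^ 2 / 8) * (2 ^ n *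
            Real.exp (θ * ((∑ σ, G σ) / 2 ^ n) + n * (θ ^ 2 * c ^ 2 / 8))) := by
          rw [← Finset.mul_sum]; gcongr
      _ = _ := by
          push_cast
          rw [show θ * ((∑ σ, G σ) / 2 ^ n) + (n + 1) * (θ ^ 2 * c ^ 2 / 8)
            = (θ * ((∑ σ, G σ) / 2 ^ n) + n * (θ ^ 2 * c ^ 2 / 8)) + θ ^ 2 * c ^ 2 / 8 by ring,
            Real.exp_add _ (θ ^ 2 * c ^ 2 / 8)]
          ring

/-- Exponential Markov inequality for counting. -/
lemma card_filter_le_of_sum_exp_le {α : Type*} [Fintype α] (p : α → Prop) [DecidablePred p]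
    (F : α → ℝ) {t B : ℝ} (hp : ∀ a, p a → t ≤ F a) (hB : ∑ a, Real.exp (F a) ≤ B) :
    ((Finset.univ.filter p).card : ℝ) ≤ B * Real.exp (-t) := by
  have h1 : ((Finset.univ.filter p).card : ℝ) * Real.exp t ≤ B := by
    refine le_trans ?_ hB
    rw [← nsmul_eq_mul, ← Finset.sum_const]
    calc _ ≤ ∑ a ∈ Finset.univ.filter p, Real.exp (F a) :=
          Finset.sum_le_sum fun a ha => Real.exp_le_exp.2 (hp a (Finset.mem_filter.1 ha).2)
      _ ≤ _ := Finset.sum_le_sum_of_subset_of_nonneg (Finset.filter_subset _ _)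
          fun _ _ _ => (Real.exp_pos _).le
  rw [Real.exp_neg, ← div_eq_mul_inv, le_div_iff₀ (Real.exp_pos t)]
  exact h1

/-- McDiarmid's inequality on the Boolean cube. -/
lemma card_filter_le_of_bounded_differences {n : ℕ} (hn : 0 < n) {c : ℝ} (hc : 0 < c)
    (F : (Fin n → Bool) → ℝ) (hF : ∀ σ i b, |F σ - F (Function.update σ i b)| ≤ c)
    (p : (Fin n → Bool) → Prop) [DecidablePred p] {μ s : ℝ} (hμ : (∑ σ, F σ) / 2 ^ n ≤ μ)
    (hs : 0 ≤ s) (hp : ∀ σ, p σ → μ + s ≤ F σ) :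
    ((Finset.univ.filter p).card : ℝ) ≤ 2 ^ n * Real.exp (-(2 * s ^ 2 / (n * c ^ 2))) := by
  have hn' : (0 : ℝ) < n := Nat.cast_pos.2 hn
  -- This `θ` minimises the exponent `n θ² c² / 8 - θ s`.
  set θ := 4 * s / (n * c ^ 2) with hθ
  have hθ0 : 0 ≤ θ := by positivity
  have h := card_filter_le_of_sum_exp_le p (fun σ => θ * F σ) (t := θ * (μ + s))
    (fun σ hσ => mul_le_mul_of_nonneg_left (hp σ hσ) hθ0)
    (sum_exp_le_of_bounded_differences θ F hF)
  refine h.trans ?_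
  rw [mul_assoc, ← Real.exp_add]
  gcongr
  have h1 : θ * ((∑ σ, F σ) / 2 ^ n) ≤ θ * μ := mul_le_mul_of_nonneg_left hμ hθ0
  have h2 : n * (θ ^ 2 * c ^ 2 / 8) - θ * s = -(2 * s ^ 2 / (n * c ^ 2)) := by
    rw [hθ]; field_simp; ring
  linarith

/-- For points `v`, `w` the left side is at most `A v + A w + |b v - b w|`, and the sign of `b v - b
w` tells which of the two to use in which supremum on the right. -/
lemma two_point_contraction {W : Type*} [Finite W] [Nonempty W] (A u b : W → ℝ)
    (h : ∀ v w, |u v - u w| ≤ |b v - b w|) :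
    (⨆ w, (A w + u w)) + ⨆ w, (A w - u w) ≤ (⨆ w, (A w + b w)) + ⨆ w, (A w - b w) := by
  have bd : ∀ f : W → ℝ, BddAbove (Set.range f) := fun f => (Set.finite_range f).bddAbove
  refine ciSup_add_ciSup_le fun v w => ?_
  have h1 := le_ciSup (bd fun w => A w + b w) v
  have h2 := le_ciSup (bd fun w => A w - b w) w
  have h3 := le_ciSup (bd fun w => A w + b w) w
  have h4 := le_ciSup (bd fun w => A w - b w) v
  have h5 := le_trans (le_abs_self _) (h v w)
  rcases abs_cases (b v - b w) with ⟨h6, _⟩ | ⟨h6, _⟩ <;> linarith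

/-- The contraction principle for Rademacher sums. -/
lemma sum_iSup_contraction {W : Type*} [Finite W] [Nonempty W] : ∀ {n : ℕ} (A : W → ℝ)
    (u b : Fin n → W → ℝ), (∀ i v w, |u i v - u i w| ≤ |b i v - b i w|) →
    ∑ σ : Fin n → Bool, ⨆ w, (A w + ∑ i, sgn (σ i) * u i w)
      ≤ ∑ σ : Fin n → Bool, ⨆ w, (A w + ∑ i, sgn (σ i) * b i w)
  | 0, A, u, b, _ => by simp
  | n + 1, A, u, b, h => by
    -- The arbitrary term `A` absorbs the first coordinate with its sign, so the others are
    -- contracted first and `two_point_contraction` then treats this one.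
    have ih := fun ε : ℝ => sum_iSup_contraction (fun w => A w + ε * u 0 w)
      (fun i => u i.succ) (fun i => b i.succ) fun i => h i.succ
    rw [sum_cube_succ, sum_cube_succ]
    simp only [Fin.sum_univ_succ, Fin.cons_zero, Fin.cons_succ, sgn_true, sgn_false,
      ← add_assoc]
    rw [Finset.sum_add_distrib]
    refine (add_le_add (ih 1) (ih (-1))).trans ?_
    rw [← Finset.sum_add_distrib]
    refine Finset.sum_le_sum fun τ _ => ?_
    have := two_point_contraction (fun w => A w + ∑ i : Fin n, sgn (τ i) * b i.succ w)
      (u 0) (b 0) (h 0)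
    refine le_trans (le_of_eq ?_) (this.trans (le_of_eq ?_)) <;> congr 2 <;> funext w <;> ring

variable {H : Type*} [NormedAddCommGroup H] [InnerProductSpace ℝ H]

/-- Cross terms cancel on averaging over signs; each coordinate is one use of the parallelogram law,
with the offset `a` carrying the induction. -/
lemma sum_norm_add_sum_sgn_smul_sq : ∀ {n : ℕ} (a : H) (φ : Fin n → H),
    ∑ σ : Fin n → Bool, ‖a + ∑ i, sgn (σ i) • φ i‖ ^ 2 = 2 ^ n * (‖a‖ ^ 2 + ∑ i, ‖φ i‖ ^ 2)
  | 0, a, φ => by simp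
  | n + 1, a, φ => by
    have ih := fun ε : ℝ => sum_norm_add_sum_sgn_smul_sq (a + ε • φ 0) fun i => φ i.succ
    rw [sum_cube_succ]
    simp only [Fin.sum_univ_succ, Fin.cons_zero, Fin.cons_succ, sgn_true, sgn_false,
      ← add_assoc]
    rw [Finset.sum_add_distrib, ih 1, ih (-1), pow_succ]
    have := parallelogram_law_with_norm ℝ a (φ 0)
    rw [one_smul, neg_one_smul, ← sub_eq_add_neg]
    simp only [sq]
    linear_combination 2 ^ n * this

/-- The Rademacher complexity of a ball of linear functionals. -/
lemma sum_iSup_inner_le {W : Type*} [Finite W] [Nonempty W] {n : ℕ} (w : W → H)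
    (φ : Fin n → H) {r : ℝ} (hr : ∀ v, ‖w v‖ ≤ r) :
    ∑ σ : Fin n → Bool, ⨆ v, ∑ i, sgn (σ i) * ⟪w v, φ i⟫_ℝ
      ≤ 2 ^ n * (r * √(∑ i, ‖φ i‖ ^ 2)) := by
  have hr0 : 0 ≤ r := (norm_nonneg _).trans (hr (Classical.arbitrary W))
  have h1 : ∀ σ : Fin n → Bool, (⨆ v, ∑ i, sgn (σ i) * ⟪w v, φ i⟫_ℝ)
      ≤ r * ‖∑ i, sgn (σ i) • φ i‖ := fun σ => ciSup_le fun v => by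
    have : ∑ i, sgn (σ i) * ⟪w v, φ i⟫_ℝ = ⟪w v, ∑ i, sgn (σ i) • φ i⟫_ℝ := by
      rw [inner_sum]
      exact Finset.sum_congr rfl fun i _ => (real_inner_smul_right _ _ _).symm
    rw [this]
    exact (real_inner_le_norm _ _).trans (mul_le_mul_of_nonneg_right (hr v) (norm_nonneg _))
  refine (Finset.sum_le_sum fun σ _ => h1 σ).trans ?_
  rw [← Finset.mul_sum, mul_left_comm]
  refine mul_le_mul_of_nonneg_left ?_ hr0
  -- Cauchy–Schwarz over the cube passes from the mean norm to the mean squared norm, which is known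
  -- exactly.
  have h2 := sq_sum_le_card_mul_sum_sq (s := (Finset.univ : Finset (Fin n → Bool)))
    (f := fun σ => ‖∑ i, sgn (σ i) • φ i‖)
  have h3 := sum_norm_add_sum_sgn_smul_sq (0 : H) φ
  simp only [zero_add, norm_zero, ne_eq, OfNat.ofNat_ne_zero, not_false_eq_true, zero_pow] at h3
  rw [h3, Finset.card_univ, card_cube, ← mul_assoc, ← sq] at h2
  have h4 := Real.sqrt_le_sqrt h2
  rwa [Real.sqrt_sq (Finset.sum_nonneg fun _ _ => norm_nonneg _), Real.sqrt_mul (by positivity),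
    Real.sqrt_sq (by positivity)] at h4

end Cube

end KernelML

namespace KernelML

/-! ### Deviations between the halves of a randomly swapped double sample -/

section SwapDeviation

variable {H : Type*} [NormedAddCommGroup H] [InnerProductSpace ℝ H] {n : ℕ}

/-- Deviation of the symmetrised process over a finite family in a ball. -/
lemma card_exists_deviation_le (hn : 0 < n) {W : Type*} [Finite W] [Nonempty W] (w : W → H)
    (φ : Bool → Fin n → H) (u : Bool → Fin n → H → ℝ)
    (h0 : ∀ b i v, 0 ≤ u b i v) (h2 : ∀ b i v, u b i v ≤ 2)
    (hlip : ∀ b i v v', |u b i v - u b i v'| ≤ |⟪v, φ b i⟫_ℝ - ⟪v', φ b i⟫_ℝ|)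
    {V ρ t : ℝ} (hV : ∀ b, ∑ i, ‖φ b i‖ ^ 2 ≤ V) (hw : ∀ v, ‖w v‖ * √V ≤ ρ) (ht : 0 ≤ t)
    (p : (Fin n → Bool) → Prop) [DecidablePred p]
    (hp : ∀ σ, p σ → ∃ v, 2 * ρ + t ≤ ∑ i, sgn (σ i) * (u false i (w v) - u true i (w v))) :
    ((Finset.univ.filter p).card : ℝ) ≤ 2 ^ n * Real.exp (-(t ^ 2 / (8 * n))) := by
  have hn' : (0 : ℝ) < n := Nat.cast_pos.2 hn
  have bd : ∀ f : W → ℝ, BddAbove (Set.range f) := fun f => (Set.finite_range f).bddAbove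
  set F : (Fin n → Bool) → ℝ :=
    fun σ => ⨆ v, ∑ i, sgn (σ i) * (u false i (w v) - u true i (w v)) with hF
  -- One sign multiplies a number in `[-2, 2]`, so flipping it moves each sum by at most 4.
  have hd : ∀ σ i b, F σ ≤ F (Function.update σ i b) + 4 := by
    intro σ i b
    refine ciSup_le fun v => ?_
    have h1 := le_ciSup (bd fun v => ∑ j, sgn (Function.update σ i b j) *
      (u false j (w v) - u true j (w v))) v
    refine le_trans ?_ (add_le_add_left h1 4)
    rw [← Finset.add_sum_erase _ _ (Finset.mem_univ i),
      ← Finset.add_sum_erase (a := i) _ (fun j => sgn (Function.update σ i b j) *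
      (u false j (w v) - u true j (w v))) (Finset.mem_univ i)]
    have h3 : ∑ j ∈ Finset.univ.erase i, sgn (Function.update σ i b j) *
        (u false j (w v) - u true j (w v))
        = ∑ j ∈ Finset.univ.erase i, sgn (σ j) * (u false j (w v) - u true j (w v)) :=
      Finset.sum_congr rfl fun j hj => by
        rw [Function.update_of_ne (Finset.ne_of_mem_erase hj)]
    rw [h3]
    have ha := h0 false i (w v)
    have hb := h0 true i (w v)
    have hc := h2 false i (w v)
    have hd := h2 true i (w v)
    rw [Function.update_self]
    cases σ i <;> cases b <;> simp only [sgn_true, sgn_false] <;> linarith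
  have hd' : ∀ σ i b, |F σ - F (Function.update σ i b)| ≤ 4 := by
    intro σ i b
    have h1 := hd σ i b
    have h3 := hd (Function.update σ i b) i (σ i)
    rw [Function.update_idem, Function.update_eq_self] at h3
    rw [abs_le]; constructor <;> linarith
  obtain ⟨v₀, hv₀⟩ := Finite.exists_max fun v => ‖w v‖
  -- The supremum is split between the two halves; contraction replaces the losses by linear
  -- functionals, and each half contributes at most `ρ`.
  have hmean : (∑ σ, F σ) / 2 ^ n ≤ 2 * ρ := by
    have hb : ∀ b, ∑ σ : Fin n → Bool, ⨆ v, ∑ i, sgn (σ i) * ⟪w v, φ b i⟫_ℝ ≤ 2 ^ n * ρ := by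
      intro b
      refine (sum_iSup_inner_le w (φ b) hv₀).trans ?_
      refine mul_le_mul_of_nonneg_left ?_ (by positivity)
      exact (mul_le_mul_of_nonneg_left (Real.sqrt_le_sqrt (hV b)) (norm_nonneg _)).trans (hw v₀)
    have c1 := sum_iSup_contraction (fun _ => 0) (fun i v => u false i (w v))
      (fun i v => ⟪w v, φ false i⟫_ℝ) fun i v v' => hlip false i (w v) (w v')
    have c2 := sum_iSup_contraction (fun _ => 0) (fun i v => -u true i (w v))
      (fun i v => ⟪w v, φ true i⟫_ℝ) fun i v v' => by
        rw [neg_sub_neg, abs_sub_comm]; exact hlip true i (w v) (w v')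
    simp only [zero_add] at c1 c2
    have c3 : ∑ σ, F σ ≤ ∑ σ : Fin n → Bool, ((⨆ v, ∑ i, sgn (σ i) * u false i (w v))
        + ⨆ v, ∑ i, sgn (σ i) * -u true i (w v)) := by
      refine Finset.sum_le_sum fun σ _ => ciSup_le fun v => ?_
      have e1 := le_ciSup (bd fun v => ∑ i, sgn (σ i) * u false i (w v)) v
      have e2 := le_ciSup (bd fun v => ∑ i, sgn (σ i) * -u true i (w v)) v
      refine le_trans (le_of_eq ?_) (add_le_add e1 e2)
      rw [← Finset.sum_add_distrib]
      exact Finset.sum_congr rfl fun i _ => by ring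
    rw [Finset.sum_add_distrib] at c3
    rw [div_le_iff₀ (by positivity)]
    have := hb false
    have := hb true
    linarith
  have := card_filter_le_of_bounded_differences hn (c := 4) (by norm_num) F hd' p hmean ht
    fun σ hσ => by
      obtain ⟨v, hv⟩ := hp σ hσ
      exact hv.trans (le_ciSup (bd fun v => ∑ i, sgn (σ i) *
        (u false i (w v) - u true i (w v))) v)
  convert this using 4
  field_simp
  ring

/-- Uniform deviation of the symmetrised process over all radii. -/
lemma card_deviation_le (hn : 0 < n) (w : (Fin n → Bool) → H)
    (φ : Bool → Fin n → H) (u : Bool → Fin n → H → ℝ)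
    (h0 : ∀ b i v, 0 ≤ u b i v) (h2 : ∀ b i v, u b i v ≤ 2)
    (hlip : ∀ b i v v', |u b i v - u b i v'| ≤ |⟪v, φ b i⟫_ℝ - ⟪v', φ b i⟫_ℝ|)
    {V s : ℝ} (hV : ∀ b, ∑ i, ‖φ b i‖ ^ 2 ≤ V) (hs : 16 * √n ≤ s)
    (p : (Fin n → Bool) → Prop) [DecidablePred p]
    (hp : ∀ σ, p σ → 8 * (‖w σ‖ * √V) + s
      < ∑ i, sgn (σ i) * (u false i (w σ) - u true i (w σ))) :
    ((Finset.univ.filter p).card : ℝ) ≤ 2 ^ n * Real.exp (-(s ^ 2 / (32 * n))) := by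
  classical
  have hn' : (0 : ℝ) < n := Nat.cast_pos.2 hn
  have hr : 0 < √(n : ℝ) := Real.sqrt_pos.2 hn'
  have hrr : √(n : ℝ) ^ 2 = n := Real.sq_sqrt hn'.le
  have hs0 : 0 ≤ s := le_trans (by positivity) hs
  -- The vector depends on `σ`, so the cube is cut into levels on which `‖w σ‖ √V` is known up to
  -- `√n`; only finitely many levels occur.
  let lev : (Fin n → Bool) → ℕ := fun σ => ⌊‖w σ‖ * √V / √n⌋₊
  obtain ⟨J, hJ⟩ : ∃ J, ∀ σ, lev σ < J := by
    obtain ⟨σ₀, h⟩ := Finite.exists_max lev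
    exact ⟨lev σ₀ + 1, fun σ => Nat.lt_succ_of_le (h σ)⟩
  have hlev : ∀ j : ℕ, ((Finset.univ.filter fun σ => p σ ∧ lev σ = j).card : ℝ)
      ≤ 2 ^ n * Real.exp (-(s ^ 2 / (32 * n))) * (1 / 2) ^ (j + 1) := by
    intro j
    -- Vectors too long for the level are replaced by 0, which puts the whole family in one ball.
    -- The allowance fits: `2 (j + 1) √n + t = 8 j √n + 8 √n + s / 2`, and `8 √n ≤ s / 2`.
    have h := card_exists_deviation_le hn
      (fun σ => if ‖w σ‖ * √V ≤ (j + 1) * √n then w σ else 0) φ u h0 h2 hlip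
      (ρ := (j + 1) * √n) (t := s / 2 + 6 * ((j + 1) * √n)) hV
      (fun σ => by
        split_ifs with hc
        · exact hc
        · rw [norm_zero, zero_mul]; positivity)
      (by positivity) (fun σ => p σ ∧ lev σ = j) (by
        rintro σ ⟨hσ, hj⟩
        refine ⟨σ, ?_⟩
        have hfl1 := Nat.floor_le (a := ‖w σ‖ * √V / √n) (by positivity)
        have hfl2 := Nat.lt_floor_add_one (‖w σ‖ * √V / √n)
        rw [show ⌊‖w σ‖ * √V / √n⌋₊ = j from hj] at hfl1 hfl2
        rw [le_div_iff₀ hr] at hfl1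
        rw [div_lt_iff₀ hr] at hfl2
        rw [if_pos hfl2.le]
        have := hp σ hσ
        nlinarith)
    refine h.trans ?_
    rw [mul_assoc]
    refine mul_le_mul_of_nonneg_left ?_ (by positivity)
    -- The surplus `6 (j + 1) √n` in `t` buys a factor `exp (-(j + 1)) ≤ 2 ^ (-(j + 1))`, so the sum
    -- over levels costs nothing.
    have e1 : s ^ 2 / (32 * n) + (j + 1 : ℕ)
        ≤ (s / 2 + 6 * ((j + 1) * √n)) ^ 2 / (8 * n) := by
      rw [div_add' _ _ _ (by positivity), div_le_div_iff₀ (by positivity) (by positivity)]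
      have e2 : s ^ 2 / 4 + 36 * (j + 1) ^ 2 * n ≤ (s / 2 + 6 * ((j + 1) * √n)) ^ 2 := by
        have : 0 ≤ s * ((j + 1) * √n) := by positivity
        nlinarith
      have e3 : ((j + 1 : ℕ) : ℝ) ≤ (j + 1 : ℝ) ^ 2 := by
        push_cast
        nlinarith [(Nat.cast_nonneg j : (0 : ℝ) ≤ j)]
      have e4 : ((j + 1 : ℕ) : ℝ) * n ≤ (j + 1 : ℝ) ^ 2 * n :=
        mul_le_mul_of_nonneg_right e3 hn'.le
      have e5 : 0 ≤ (j + 1 : ℝ) ^ 2 * n := by positivity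
      have e6 : 8 * s ^ 2 + 256 * (((j + 1 : ℕ) : ℝ) * n)
          ≤ 32 * (s / 2 + 6 * ((j + 1) * √n)) ^ 2 := by linarith
      nlinarith [mul_le_mul_of_nonneg_right e6 hn'.le]
    calc _ ≤ Real.exp (-(s ^ 2 / (32 * n)) + (j + 1 : ℕ) * (-1)) :=
          Real.exp_le_exp.2 (by linarith)
      _ = Real.exp (-(s ^ 2 / (32 * n))) * Real.exp (-1) ^ (j + 1) := by
          rw [Real.exp_add, Real.exp_nat_mul]
      _ ≤ _ := by
          have : Real.exp (-1) ≤ 1 / 2 := by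
            rw [Real.exp_neg, one_div]
            exact inv_anti₀ (by norm_num) (by linarith [Real.add_one_le_exp (1 : ℝ)])
          gcongr
  have hcover : Finset.univ.filter p
      ⊆ (Finset.range J).biUnion fun j => Finset.univ.filter fun σ => p σ ∧ lev σ = j := by
    intro σ hσ
    simp only [Finset.mem_biUnion, Finset.mem_range, Finset.mem_filter, Finset.mem_univ,
      true_and] at hσ ⊢
    exact ⟨lev σ, hJ σ, hσ, rfl⟩
  have hc1 : ((Finset.univ.filter p).card : ℝ) ≤ ∑ j ∈ Finset.range J,
      ((Finset.univ.filter fun σ => p σ ∧ lev σ = j).card : ℝ) := by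
    exact_mod_cast (Finset.card_le_card hcover).trans Finset.card_biUnion_le
  have hgeo : ∑ j ∈ Finset.range J, (1 / 2 : ℝ) ^ (j + 1) ≤ 1 := by
    have : ∀ J : ℕ, ∑ j ∈ Finset.range J, (1 / 2 : ℝ) ^ (j + 1) = 1 - (1 / 2) ^ J := by
      intro J
      induction J with
      | zero => simp
      | succ k ih => rw [Finset.sum_range_succ, ih, pow_succ]; ring
    rw [this]
    have : (0 : ℝ) ≤ (1 / 2) ^ J := by positivity
    linarith
  calc _ ≤ _ := hc1
    _ ≤ ∑ j ∈ Finset.range J, 2 ^ n * Real.exp (-(s ^ 2 / (32 * n))) * (1 / 2) ^ (j + 1) :=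
        Finset.sum_le_sum fun j _ => hlev j
    _ ≤ _ := by
        rw [← Finset.mul_sum]
        exact mul_le_of_le_one_right (by positivity) hgeo

/-- The left side is `2 exp (-x / 2) cosh (x / 2) ≤ 2 exp (-x / 2 + x² / 8)`, and `x² ≤ x`. -/
lemma one_add_exp_neg_le {x : ℝ} (h0 : 0 ≤ x) (h1 : x ≤ 1) :
    1 + Real.exp (-x) ≤ 2 * Real.exp (-(3 * x / 8)) := by
  have e : 1 + Real.exp (-x) = 2 * (Real.exp (-(x / 2)) * Real.cosh (x / 2)) := by
    rw [Real.cosh_eq, mul_div_assoc', mul_div_cancel₀ _ (two_ne_zero), mul_add, ← Real.exp_add,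
      ← Real.exp_add]
    rw [neg_add_cancel, Real.exp_zero]; congr 2; ring
  rw [e]
  refine mul_le_mul_of_nonneg_left ?_ (by norm_num)
  refine (mul_le_mul_of_nonneg_left (Real.cosh_le_exp_half_sq _) (Real.exp_pos _).le).trans ?_
  rw [← Real.exp_add]
  exact Real.exp_le_exp.2 (by nlinarith)

/-- Lower tail of a random selection of one non-negative number from each pair. -/
lemma card_selection_lt_le (x : Bool → Fin n → ℝ) (hx : ∀ b i, 0 ≤ x b i) (m : Fin n → ℝ)
    {τ : ℝ} (hτ : 0 < τ) (hm0 : ∀ i, 0 ≤ m i) (hmτ : ∀ i, m i ≤ τ) (hm : ∀ i, ∃ b, m i ≤ x b i) :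
    ((Finset.univ.filter fun σ : Fin n → Bool => ∑ i, x (σ i) i < (∑ i, m i) / 4).card : ℝ)
      ≤ 2 ^ n * Real.exp (-((∑ i, m i) / (8 * τ))) := by
  have hsum : ∑ σ : Fin n → Bool, Real.exp (-((∑ i, x (σ i) i) / τ))
      ≤ 2 ^ n * Real.exp (-(3 * ((∑ i, m i) / τ) / 8)) := by
    have e1 : ∀ σ : Fin n → Bool, Real.exp (-((∑ i, x (σ i) i) / τ))
        = ∏ i, Real.exp (-(x (σ i) i / τ)) := fun σ => by
      rw [← Real.exp_sum, Finset.sum_neg_distrib, Finset.sum_div]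
    rw [Finset.sum_congr rfl fun σ _ => e1 σ]
    -- The coordinates of `σ` are independent, so the exponential moment factors over the pairs; in
    -- each pair one exponential is at most 1 and the other at most `exp (-m i / τ)`.
    have e2 := Finset.prod_univ_sum (fun _ : Fin n => (Finset.univ : Finset Bool))
      fun i b => Real.exp (-(x b i / τ))
    rw [Fintype.piFinset_univ] at e2
    rw [← e2]
    have e3 : ∀ i, ∑ b, Real.exp (-(x b i / τ)) ≤ 2 * Real.exp (-(3 * (m i / τ) / 8)) := by
      intro i
      refine le_trans ?_ (one_add_exp_neg_le (div_nonneg (hm0 i) hτ.le)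
        ((div_le_one hτ).2 (hmτ i)))
      have f1 : ∀ b, Real.exp (-(x b i / τ)) ≤ 1 := fun b =>
        Real.exp_le_one_iff.2 (neg_nonpos.2 (div_nonneg (hx b i) hτ.le))
      obtain ⟨b, hb⟩ := hm i
      have f2 : Real.exp (-(x b i / τ)) ≤ Real.exp (-(m i / τ)) :=
        Real.exp_le_exp.2 (neg_le_neg (div_le_div_of_nonneg_right hb hτ.le))
      rw [Fintype.sum_bool]
      cases b
      · linarith [f1 true]
      · linarith [f1 false]
    refine (Finset.prod_le_prod (fun i _ => Finset.sum_nonneg fun _ _ => (Real.exp_pos _).le)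
      fun i _ => e3 i).trans (le_of_eq ?_)
    rw [Finset.prod_mul_distrib, Finset.prod_const, Finset.card_univ, Fintype.card_fin,
      ← Real.exp_sum, Finset.sum_neg_distrib, ← Finset.sum_div, ← Finset.mul_sum, Finset.sum_div]
  -- The moment gives the rate `3 / 8` and the threshold takes back `1 / 4`, which leaves `1 / 8`.
  have h := card_filter_le_of_sum_exp_le
    (fun σ : Fin n → Bool => ∑ i, x (σ i) i < (∑ i, m i) / 4)
    (fun σ => -((∑ i, x (σ i) i) / τ)) (t := -((∑ i, m i) / 4 / τ))
    (fun σ hσ => neg_le_neg (div_le_div_of_nonneg_right (le_of_lt hσ) hτ.le)) hsum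
  refine h.trans (le_of_eq ?_)
  rw [mul_assoc, ← Real.exp_add]
  congr 2
  field_simp
  ring

/-- The `L` largest of finitely many non-negative numbers. -/
lemma exists_largest (M : Fin n → ℝ) (hM : ∀ i, 0 ≤ M i) : ∀ L ≤ n,
    ∃ (T : Finset (Fin n)) (τ : ℝ), T.card = L ∧ 0 ≤ τ ∧ (∀ i ∈ T, τ ≤ M i) ∧ ∀ i ∉ T, M i ≤ τ
  | 0, _ => ⟨∅, ∑ i, M i, rfl, Finset.sum_nonneg fun i _ => hM i, by simp, fun i _ =>
      Finset.single_le_sum (fun j _ => hM j) (Finset.mem_univ i)⟩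
  | L + 1, hL => by
    obtain ⟨T, τ, hT, hτ, h1, h2⟩ := exists_largest M hM L (by omega)
    have hne : (Finset.univ \ T).Nonempty := by
      rw [← Finset.card_pos, Finset.card_sdiff_of_subset (Finset.subset_univ _),
        Finset.card_univ, Fintype.card_fin]
      omega
    obtain ⟨i₀, hi₀, hmax⟩ := Finset.exists_max_image _ M hne
    have hi₀' : i₀ ∉ T := (Finset.mem_sdiff.1 hi₀).2
    refine ⟨insert i₀ T, M i₀, by rw [Finset.card_insert_of_notMem hi₀', hT], hM _, ?_, ?_⟩
    · intro i hi
      rcases Finset.mem_insert.1 hi with rfl | hi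
      · exact le_rfl
      · exact (h2 _ hi₀').trans (h1 i hi)
    · intro i hi
      exact hmax i (Finset.mem_sdiff.2 ⟨Finset.mem_univ _,
        fun h => hi (Finset.mem_insert_of_mem h)⟩)

/-- Deviation between the two halves of a randomly swapped sample, relative to the selected half. -/
lemma card_swap_deviation_le (hn : 0 < n) (w : (Fin n → Bool) → H)
    (φ : Bool → Fin n → H) (u : Bool → Fin n → H → ℝ)
    (h0 : ∀ b i v, 0 ≤ u b i v) (h2 : ∀ b i v, u b i v ≤ 2)
    (hlip : ∀ b i v v', |u b i v - u b i v'| ≤ |⟪v, φ b i⟫_ℝ - ⟪v', φ b i⟫_ℝ|)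
    {s : ℝ} (hs : 32 * √n ≤ s)
    (p : (Fin n → Bool) → Prop) [DecidablePred p]
    (hp : ∀ σ, p σ → 16 * (‖w σ‖ * √(∑ i, ‖φ (σ i) i‖ ^ 2)) + s
      < ∑ i, sgn (σ i) * (u false i (w σ) - u true i (w σ))) :
    ((Finset.univ.filter p).card : ℝ) ≤ 2 ^ n * (3 * Real.exp (-(s ^ 2 / (128 * n)))) := by
  classical
  have hn' : (0 : ℝ) < n := Nat.cast_pos.2 hn
  have hs0 : 0 ≤ s := le_trans (by positivity) hs
  have hterm : ∀ (b : Bool) i v, sgn b * (u false i v - u true i v) ≤ 2 := by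
    intro b i v
    have ha := h0 false i v
    have hb := h0 true i v
    have hc := h2 false i v
    have hd := h2 true i v
    cases b <;> simp only [sgn_true, sgn_false] <;> linarith
  by_cases hsn : 2 * (n : ℝ) < s
  -- Each summand is at most 2, so the event is empty when `s > 2 n`. Otherwise `s / 8 ≤ n`, and `s²
  -- / (128 n) ≤ s / 64`.
  · have : Finset.univ.filter p = ∅ := by
      refine Finset.filter_eq_empty_iff.2 fun σ _ hσ => ?_
      have h1 := hp σ hσ
      have h3 : ∑ i, sgn (σ i) * (u false i (w σ) - u true i (w σ)) ≤ 2 * n := by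
        refine (Finset.sum_le_sum fun i _ => hterm (σ i) i (w σ)).trans (le_of_eq ?_)
        simp [mul_comm]
      have h4 : 0 ≤ 16 * (‖w σ‖ * √(∑ i, ‖φ (σ i) i‖ ^ 2)) := by positivity
      linarith
    rw [this, Finset.card_empty, Nat.cast_zero]
    positivity
  rw [not_lt] at hsn
  set M : Fin n → ℝ := fun i => max (‖φ false i‖ ^ 2) (‖φ true i‖ ^ 2) with hM
  have hM0 : ∀ i, 0 ≤ M i := fun i => le_max_of_le_left (sq_nonneg _)
  have hMb : ∀ b i, ‖φ b i‖ ^ 2 ≤ M i := fun b i => by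
    cases b
    · exact le_max_left _ _
    · exact le_max_right _ _
  have hMe : ∀ i, ∃ b, M i ≤ ‖φ b i‖ ^ 2 := fun i => by
    rcases max_choice (‖φ false i‖ ^ 2) (‖φ true i‖ ^ 2) with h | h
    · exact ⟨false, h.le⟩
    · exact ⟨true, h.le⟩
  -- Dropping `L` pairs costs at most `2 L ≤ s / 4` in the deviation.
  set L := ⌊s / 8⌋₊ with hL
  have hL1 : (L : ℝ) ≤ s / 8 := Nat.floor_le (by positivity)
  have hL2 : s / 8 < L + 1 := Nat.lt_floor_add_one _
  have hLn : L ≤ n := by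
    have : (L : ℝ) ≤ n := by linarith
    exact_mod_cast this
  obtain ⟨T, τ, hT, hτ, hT1, hT2⟩ := exists_largest M hM0 L hLn
  set V := ∑ i, if i ∈ T then 0 else M i with hV
  have hV0 : 0 ≤ V := Finset.sum_nonneg fun i _ => by split_ifs <;> [exact le_rfl; exact hM0 i]
  -- the selected half carries a quarter of the truncated total
  have hsel : ((Finset.univ.filter fun σ : Fin n → Bool =>
      ∑ i, ‖φ (σ i) i‖ ^ 2 < V / 4).card : ℝ)
      ≤ 2 ^ n * (2 * Real.exp (-(s ^ 2 / (128 * n)))) := by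
    rcases hτ.eq_or_lt with h | hτ0
    · have hVz : V = 0 := Finset.sum_eq_zero fun i _ => by
        split_ifs with hi
        · rfl
        · exact le_antisymm (h ▸ hT2 i hi) (hM0 i)
      have : (Finset.univ.filter fun σ : Fin n → Bool => ∑ i, ‖φ (σ i) i‖ ^ 2 < V / 4) = ∅ := by
        refine Finset.filter_eq_empty_iff.2 fun σ _ hσ => ?_
        rw [hVz, zero_div] at hσ
        exact absurd hσ (not_lt.2 (Finset.sum_nonneg fun _ _ => sq_nonneg _))
      rw [this, Finset.card_empty, Nat.cast_zero]
      positivity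
    -- Truncation at the threshold `τ` makes the Chernoff bound effective: the truncated total
    -- dominates `V`, and the `L` largest pairs alone contribute `L τ`, so the exponent is at least
    -- `L / 8`.
    · set m : Fin n → ℝ := fun i => min (M i) τ with hm
      have h1 := card_selection_lt_le (fun b i => ‖φ b i‖ ^ 2) (fun _ _ => sq_nonneg _) m hτ0
        (fun i => le_min (hM0 i) hτ) (fun i => min_le_right _ _)
        (fun i => (hMe i).imp fun b hb => (min_le_left _ _).trans hb)
      have hmV : V ≤ ∑ i, m i := Finset.sum_le_sum fun i _ => by
        split_ifs with hi
        · exact le_min (hM0 i) hτ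
        · exact le_min le_rfl (hT2 i hi)
      have hmL : L * τ ≤ ∑ i, m i := by
        calc (L : ℝ) * τ = ∑ i ∈ T, τ := by rw [Finset.sum_const, hT, nsmul_eq_mul]
          _ ≤ ∑ i ∈ T, m i := Finset.sum_le_sum fun i hi => le_min (hT1 i hi) le_rfl
          _ ≤ _ := Finset.sum_le_sum_of_subset_of_nonneg (Finset.subset_univ _)
            fun i _ _ => le_min (hM0 i) hτ
      have h3 : ((Finset.univ.filter fun σ : Fin n → Bool =>
          ∑ i, ‖φ (σ i) i‖ ^ 2 < V / 4).card : ℝ)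
          ≤ (Finset.univ.filter fun σ : Fin n → Bool =>
          ∑ i, ‖φ (σ i) i‖ ^ 2 < (∑ i, m i) / 4).card := by
        refine Nat.cast_le.2 (Finset.card_le_card fun σ hσ => ?_)
        rw [Finset.mem_filter] at hσ ⊢
        exact ⟨hσ.1, hσ.2.trans_le (by linarith)⟩
      refine (h3.trans h1).trans ?_
      refine mul_le_mul_of_nonneg_left ?_ (by positivity)
      have h4 : (L : ℝ) / 8 ≤ (∑ i, m i) / (8 * τ) := by
        rw [div_le_div_iff₀ (by norm_num) (by positivity)]
        linarith
      have h5 : s ^ 2 / (128 * n) ≤ s / 64 := by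
        rw [div_le_div_iff₀ (by positivity) (by norm_num)]
        nlinarith
      -- Rounding `s / 8` down to `L` loses at most `1 / 8` in the exponent.
      have h6 : Real.exp (1 / 8) ≤ 2 := by
        have := Real.exp_bound_div_one_sub_of_interval' (x := 1 / 8) (by norm_num) (by norm_num)
        norm_num at this ⊢
        linarith
      calc _ ≤ Real.exp (1 / 8 + -(s ^ 2 / (128 * n))) := Real.exp_le_exp.2 (by linarith)
        _ = Real.exp (1 / 8) * Real.exp (-(s ^ 2 / (128 * n))) := Real.exp_add _ _
        _ ≤ _ := by gcongr
  -- off the largest pairs, the deviation is controlled by `V`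
  have hdev : ((Finset.univ.filter fun σ : Fin n → Bool =>
      p σ ∧ ¬ ∑ i, ‖φ (σ i) i‖ ^ 2 < V / 4).card : ℝ)
      ≤ 2 ^ n * Real.exp (-(s ^ 2 / (128 * n))) := by
    -- After the dropped pairs `3 s / 4` of the slack remains. Since the selected half carries at
    -- least `V / 4`, `√V` is at most twice its root, which turns the coefficient 8 into 16.
    have h := card_deviation_le hn w (fun b i => if i ∈ T then 0 else φ b i)
      (fun b i v => if i ∈ T then 0 else u b i v)
      (fun b i v => by split_ifs <;> [exact le_rfl; exact h0 b i v])
      (fun b i v => by split_ifs <;> [norm_num; exact h2 b i v])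
      (fun b i v v' => by
        split_ifs
        · simp
        · exact hlip b i v v')
      (V := V) (s := 3 * s / 4)
      (fun b => Finset.sum_le_sum fun i _ => by
        split_ifs
        · simp
        · exact hMb b i)
      (by have := Real.sqrt_nonneg (n : ℝ); linarith)
      (fun σ => p σ ∧ ¬ ∑ i, ‖φ (σ i) i‖ ^ 2 < V / 4) (by
        rintro σ ⟨hσ, hsel⟩
        have h1 := hp σ hσ
        have h3 : ∑ i, sgn (σ i) * (u false i (w σ) - u true i (w σ))
            ≤ (∑ i, sgn (σ i) * ((if i ∈ T then 0 else u false i (w σ))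
              - if i ∈ T then 0 else u true i (w σ))) + 2 * L := by
          rw [← hT, ← Finset.sum_add_sum_compl T, ← Finset.sum_add_sum_compl T
            fun i => sgn (σ i) * ((if i ∈ T then 0 else u false i (w σ))
              - if i ∈ T then 0 else u true i (w σ))]
          have k1 : ∑ i ∈ T, sgn (σ i) * (u false i (w σ) - u true i (w σ)) ≤ 2 * T.card := by
            refine (Finset.sum_le_sum fun i _ => hterm (σ i) i (w σ)).trans (le_of_eq ?_)
            simp [mul_comm]
          have k2 : ∑ i ∈ T, sgn (σ i) * ((if i ∈ T then 0 else u false i (w σ))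
              - if i ∈ T then 0 else u true i (w σ)) = 0 :=
            Finset.sum_eq_zero fun i hi => by simp [hi]
          have k3 : ∑ i ∈ Tᶜ, sgn (σ i) * ((if i ∈ T then 0 else u false i (w σ))
              - if i ∈ T then 0 else u true i (w σ))
              = ∑ i ∈ Tᶜ, sgn (σ i) * (u false i (w σ) - u true i (w σ)) :=
            Finset.sum_congr rfl fun i hi => by simp [Finset.mem_compl.1 hi]
          rw [k2, k3]
          linarith
        have h4 : √V ≤ 2 * √(∑ i, ‖φ (σ i) i‖ ^ 2) := by
          rw [Real.sqrt_le_left (by positivity), mul_pow,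
            Real.sq_sqrt (Finset.sum_nonneg fun _ _ => sq_nonneg _)]
          rw [not_lt] at hsel
          linarith
        have h5 := mul_le_mul_of_nonneg_left h4 (norm_nonneg (w σ))
        linarith)
    refine h.trans ?_
    refine mul_le_mul_of_nonneg_left (Real.exp_le_exp.2 (neg_le_neg ?_)) (by positivity)
    rw [div_le_div_iff₀ (by positivity) (by positivity)]
    nlinarith [mul_nonneg (sq_nonneg s) hn'.le]
  have hsub : Finset.univ.filter p ⊆ (Finset.univ.filter fun σ : Fin n → Bool =>
      ∑ i, ‖φ (σ i) i‖ ^ 2 < V / 4) ∪ Finset.univ.filter fun σ : Fin n → Bool =>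
      p σ ∧ ¬ ∑ i, ‖φ (σ i) i‖ ^ 2 < V / 4 := by
    intro σ hσ
    simp only [Finset.mem_union, Finset.mem_filter, Finset.mem_univ, true_and] at hσ ⊢
    by_cases h : ∑ i, ‖φ (σ i) i‖ ^ 2 < V / 4
    · exact Or.inl h
    · exact Or.inr ⟨hσ, h⟩
  have hcard := (Nat.cast_le (α := ℝ)).2
    ((Finset.card_le_card hsub).trans (Finset.card_union_le _ _))
  push_cast at hcard
  linarith

end SwapDeviation

end KernelML

namespace KernelML

/-! ### Symmetrisation by a ghost sample -/

section Symmetrisation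

open ProbabilityTheory

variable {X : Type*} [MeasurableSpace X] {N : ℕ}

/-- A sample mean of a function with values in `[0, 2]` rarely falls far below its expectation. -/
lemma half_le_measure_sum_ge (D : Measure X) [IsProbabilityMeasure D] {g : X → ℝ}
    (hg : Measurable g) (h0 : ∀ z, 0 ≤ g z) (h2 : ∀ z, g z ≤ 2) {s : ℝ} (hs : 0 < s)
    (hsN : 2 * N ≤ s ^ 2) :
    (1 / 2 : ENNReal) ≤ Measure.pi (fun _ : Fin N => D)
      {x | N * ∫ z, g z ∂D - s < ∑ i, g (x i)} := by
  set μ := Measure.pi fun _ : Fin N => D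
  have hmi : ∀ i : Fin N, Measurable fun x : Fin N → X => g (x i) := fun i =>
    hg.comp (measurable_pi_apply i)
  have hbd : ∀ i : Fin N, ∀ᵐ x ∂μ, g (x i) ∈ Set.Icc (0 : ℝ) 2 := fun i =>
    Filter.Eventually.of_forall fun x => ⟨h0 _, h2 _⟩
  have hL : ∀ i : Fin N, MemLp (fun x : Fin N → X => g (x i)) 2 μ := fun i =>
    memLp_of_bounded (hbd i) (hmi i).aestronglyMeasurable 2
  have hind : iIndepFun (fun (i : Fin N) (x : Fin N → X) => g (x i)) μ :=
    iIndepFun_pi (X := fun _ : Fin N => g) fun _ => hg.aemeasurable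
  -- A variable with values in `[0, 2]` has variance at most 1; Chebyshev then gives `N / s² ≤ 1 /
  -- 2`.
  have hvar : Var[∑ i, fun x : Fin N → X => g (x i); μ] ≤ N := by
    rw [IndepFun.variance_sum (fun i _ => hL i) fun i _ j _ hij => hind.indepFun hij]
    refine (Finset.sum_le_sum fun i _ => variance_le_sq_of_bounded (hbd i)
      (hmi i).aemeasurable).trans (le_of_eq ?_)
    simp
  have hmean : ∫ x, (∑ i, fun x : Fin N → X => g (x i)) x ∂μ = N * ∫ z, g z ∂D := by
    simp only [Finset.sum_apply]
    rw [integral_finsetSum _ fun i _ => (hL i).integrable one_le_two]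
    have : ∀ i : Fin N, ∫ x, g (x i) ∂μ = ∫ z, g z ∂D := fun i => by
      have hmp := measurePreserving_eval (fun _ : Fin N => D) i
      rw [← hmp.map_eq, integral_map hmp.measurable.aemeasurable hg.aestronglyMeasurable]
    simp [this]
  have hch := meas_ge_le_variance_div_sq (memLp_finsetSum' Finset.univ fun i _ => hL i) hs
  rw [hmean] at hch
  have hle : ENNReal.ofReal (Var[∑ i, fun x : Fin N → X => g (x i); μ] / s ^ 2) ≤ 1 / 2 := by
    rw [show (1 / 2 : ENNReal) = ENNReal.ofReal (1 / 2) by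
      rw [ENNReal.ofReal_div_of_pos two_pos]; simp]
    refine ENNReal.ofReal_le_ofReal ?_
    rw [div_le_iff₀ (by positivity)]
    linarith
  have hms : MeasurableSet {x : Fin N → X | N * ∫ z, g z ∂D - s < ∑ i, g (x i)} :=
    measurableSet_lt measurable_const (Finset.measurable_sum _ fun i _ => hmi i)
  have hc : μ {x : Fin N → X | N * ∫ z, g z ∂D - s < ∑ i, g (x i)}ᶜ ≤ 1 / 2 := by
    refine (measure_mono fun x hx => ?_).trans (hch.trans hle)
    simp only [Set.mem_compl_iff, Set.mem_ofPred_eq, not_lt] at hx ⊢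
    rw [Finset.sum_apply, abs_sub_comm]
    exact le_trans (by linarith) (le_abs_self _)
  have hadd := measure_add_measure_compl (μ := μ) hms
  rw [measure_univ] at hadd
  by_contra hlt
  rw [not_le] at hlt
  have : μ {x : Fin N → X | N * ∫ z, g z ∂D - s < ∑ i, g (x i)} +
      μ {x : Fin N → X | N * ∫ z, g z ∂D - s < ∑ i, g (x i)}ᶜ < 1 / 2 + 1 / 2 :=
    ENNReal.add_lt_add_of_lt_of_le (measure_ne_top _ _) hlt hc
  rw [hadd, ENNReal.add_halves] at this
  exact lt_irrefl _ this

/-- Swap the pairs on which `σ` is false. -/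
def swapPairs (σ : Fin N → Bool) (P : Fin N → X × X) : Fin N → X × X :=
  fun i => if σ i then P i else (P i).swap

lemma measurePreserving_swapPairs (D : Measure X) [IsProbabilityMeasure D] (σ : Fin N → Bool) :
    MeasurePreserving (swapPairs σ) (Measure.pi fun _ : Fin N => D.prod D)
      (Measure.pi fun _ : Fin N => D.prod D) := by
  refine measurePreserving_pi (fun _ : Fin N => D.prod D) (fun _ : Fin N => D.prod D)
    (f := fun i p => if σ i then p else p.swap) fun i => ?_
  cases σ i
  · simpa using Measure.measurePreserving_swap
  · simp only [if_true]
    exact MeasurePreserving.id _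

open Classical in
/-- If every pair of samples lies in `E` for few of its swaps, then `E` has small measure. -/
lemma measure_prod_le_of_card_swap_le (D : Measure X) [IsProbabilityMeasure D]
    {E : Set ((Fin N → X) × (Fin N → X))} (hE : MeasurableSet E) {p : ℝ}
    (hp : ∀ P : Fin N → X × X,
      ((Finset.univ.filter fun σ : Fin N → Bool =>
        ((fun i => (swapPairs σ P i).1), fun i => (swapPairs σ P i).2) ∈ E).card : ℝ)
        ≤ 2 ^ N * p) :
    ((Measure.pi fun _ : Fin N => D).prod (Measure.pi fun _ : Fin N => D)) E
      ≤ ENNReal.ofReal p := by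
  classical
  set ν := Measure.pi fun _ : Fin N => D.prod D
  have he := measurePreserving_arrowProdEquivProdArrow X X (Fin N) (fun _ => D) (fun _ => D)
  set E' : Set (Fin N → X × X) := MeasurableEquiv.arrowProdEquivProdArrow X X (Fin N) ⁻¹' E
  have hE' : MeasurableSet E' := he.measurable hE
  have hm : ∀ σ : Fin N → Bool, ν (swapPairs σ ⁻¹' E') = ν E' := fun σ =>
    (measurePreserving_swapPairs D σ).measure_preimage hE'.nullMeasurableSet
  -- The law of the independent pairs is invariant under every swap, so the measure can be averaged
  -- over all swaps and counted inside the integral.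
  have hsum : (2 ^ N : ENNReal) * ν E' ≤ ENNReal.ofReal (2 ^ N * p) := by
    calc (2 ^ N : ENNReal) * ν E' = ∑ σ : Fin N → Bool, ν (swapPairs σ ⁻¹' E') := by
          simp [hm]
      _ = ∑ σ : Fin N → Bool, ∫⁻ P, (swapPairs σ ⁻¹' E').indicator 1 P ∂ν := by
          refine Finset.sum_congr rfl fun σ _ => ?_
          rw [lintegral_indicator_one ((measurePreserving_swapPairs D σ).measurable hE')]
      _ = ∫⁻ P, ∑ σ : Fin N → Bool, (swapPairs σ ⁻¹' E').indicator 1 P ∂ν := by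
          rw [lintegral_finsetSum]
          intro σ _
          exact measurable_one.indicator ((measurePreserving_swapPairs D σ).measurable hE')
      _ ≤ ∫⁻ _, ENNReal.ofReal (2 ^ N * p) ∂ν := by
          refine lintegral_mono fun P => ?_
          refine le_trans (le_of_eq ?_) (ENNReal.ofReal_le_ofReal (hp P))
          rw [ENNReal.ofReal_natCast, Finset.card_filter, Nat.cast_sum]
          refine Finset.sum_congr rfl fun σ _ => ?_
          rw [Set.indicator_apply]
          simp only [Pi.one_apply, Nat.cast_ite, Nat.cast_one, Nat.cast_zero]
          rfl
      _ = _ := by simp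
  rw [← he.measure_preimage hE.nullMeasurableSet]
  rw [ENNReal.ofReal_mul (by positivity), ENNReal.ofReal_pow (by norm_num),
    ENNReal.ofReal_ofNat] at hsum
  exact (ENNReal.mul_le_mul_iff_right (by positivity) (by simp)).1 hsum

open Classical in
/-- Symmetrisation by a ghost sample for a sample-dependent loss `h` with a sample-dependent
allowance `pen`. -/
lemma measure_deviation_le_of_card_swap_le (D : Measure X) [IsProbabilityMeasure D]
    {h : (Fin N → X) → X → ℝ} (hh : Measurable (Function.uncurry h)) (h0 : ∀ x z, 0 ≤ h x z)
    (h2 : ∀ x z, h x z ≤ 2) {pen : (Fin N → X) → ℝ} (hpen : Measurable pen) {s p : ℝ}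
    (hs : 0 < s) (hsN : 2 * N ≤ s ^ 2)
    (hp : ∀ P : Fin N → X × X,
      ((Finset.univ.filter fun σ : Fin N → Bool =>
        pen (fun i => (swapPairs σ P i).1) + s
          < ∑ i, h (fun i => (swapPairs σ P i).1) (swapPairs σ P i).2
            - ∑ i, h (fun i => (swapPairs σ P i).1) (swapPairs σ P i).1).card : ℝ)
        ≤ 2 ^ N * p) :
    Measure.pi (fun _ : Fin N => D)
      {x | pen x + 2 * s < N * ∫ z, h x z ∂D - ∑ i, h x (x i)} ≤ 2 * ENNReal.ofReal p := by
  classical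
  set μ := Measure.pi fun _ : Fin N => D
  set B := {x : Fin N → X | pen x + 2 * s < N * ∫ z, h x z ∂D - ∑ i, h x (x i)} with hB
  set E := {q : (Fin N → X) × (Fin N → X) |
    pen q.1 + s < ∑ i, h q.1 (q.2 i) - ∑ i, h q.1 (q.1 i)} with hEdef
  have hm1 : ∀ i, Measurable fun q : (Fin N → X) × (Fin N → X) => h q.1 (q.2 i) := fun i =>
    hh.comp (measurable_fst.prodMk ((measurable_pi_apply i).comp measurable_snd))
  have hm2 : ∀ i, Measurable fun x : Fin N → X => h x (x i) := fun i =>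
    hh.comp (measurable_id.prodMk (measurable_pi_apply i))
  have hE : MeasurableSet E := measurableSet_lt ((hpen.comp measurable_fst).add measurable_const)
    ((Finset.measurable_sum _ fun i _ => hm1 i).sub
      (Finset.measurable_sum _ fun i _ => (hm2 i).comp measurable_fst))
  have hint : Measurable fun x => ∫ z, h x z ∂D :=
    (StronglyMeasurable.integral_prod_right hh.stronglyMeasurable).measurable
  have hBm : MeasurableSet B := measurableSet_lt (hpen.add measurable_const)
    ((hint.const_mul _).sub (Finset.measurable_sum _ fun i _ => hm2 i))
  have hprod := measure_prod_le_of_card_swap_le D hE hp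
  rw [Measure.prod_apply hE] at hprod
  -- Given a bad training sample, the ghost sum exceeds its mean minus `s` with probability at least
  -- one half; the other `s` of the allowance `2 s` is left for the event `E`.
  have hlow : (1 / 2 : ENNReal) * μ B ≤ ∫⁻ x, μ (Prod.mk x ⁻¹' E) ∂μ := by
    rw [← setLIntegral_const]
    refine (setLIntegral_mono' hBm fun x hx => ?_).trans (setLIntegral_le_lintegral _ _)
    refine (half_le_measure_sum_ge D (N := N) (g := h x) (hh.comp measurable_prodMk_left)
      (h0 x) (h2 x) hs hsN).trans (measure_mono fun x' hx' => ?_)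
    simp only [hEdef, hB, Set.mem_ofPred_eq, Set.mem_preimage] at hx hx' ⊢
    linarith
  calc μ B = 2 * ((1 / 2 : ENNReal) * μ B) := by
        rw [← mul_assoc, one_div, ENNReal.mul_inv_cancel (by norm_num) (by norm_num), one_mul]
    _ ≤ _ := by gcongr; exact hlow.trans hprod

end Symmetrisation

/-! ### Generalisation bound for the trained, rescaled kernel model -/

section Generalisation

variable {X : Type*} {H : Type*} [NormedAddCommGroup H] [InnerProductSpace ℝ H] {N : ℕ}

/-- Determinant and adjugate are polynomial in the entries; the total inverse makes this valid for
singular matrices as well. -/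
lemma measurable_inv_apply {α : Type*} [MeasurableSpace α] {M : α → Matrix (Fin N) (Fin N) ℝ}
    (hM : ∀ i j, Measurable fun a => M a i j) (i j : Fin N) : Measurable fun a => (M a)⁻¹ i j := by
  have hdet : ∀ {M : α → Matrix (Fin N) (Fin N) ℝ}, (∀ i j, Measurable fun a => M a i j) →
      Measurable fun a => (M a).det := by
    intro M hM
    simp only [Matrix.det_apply]
    exact Finset.measurable_sum _ fun σ _ =>
      (Finset.measurable_prod _ fun i _ => hM _ _).const_smul _
  simp only [Matrix.inv_def, Matrix.smul_apply, Ring.inverse_eq_inv', smul_eq_mul,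
    Matrix.adjugate_apply]
  refine (hdet hM).inv.mul (hdet fun k k' => ?_)
  by_cases hk : k = j
  · subst hk
    simp only [Matrix.updateRow_self]
    exact measurable_const
  · simp only [Matrix.updateRow_ne hk]
    exact hM _ _

/-- The scale factor depends on the sample; moving it onto the weight leaves the features fixed
while pairs are swapped. -/
lemma trainedWeight_rescale_inner (φ : X → H) (l : ℝ) (x : Fin N → X) (y : Fin N → ℝ) (z : X) :
    ⟪trainedWeight (rescale φ x) l x y, rescale φ x z⟫_ℝ
      = ⟪√((N : ℝ) / (kernelMatrix φ x).trace) • trainedWeight (rescale φ x) l x y, φ z⟫_ℝ := by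
  rw [rescale, real_inner_smul_right, real_inner_smul_left]

/-- The scale factor cancels against the root of the trace, which is how the penalty on the selected
half becomes `‖w‖ √N`. -/
lemma norm_rescaled_weight_mul_le (φ : X → H) (x : Fin N → X) (w : H) :
    ‖√((N : ℝ) / (kernelMatrix φ x).trace) • w‖ * √(∑ i, ‖φ (x i)‖ ^ 2) ≤ ‖w‖ * √N := by
  have htr : (kernelMatrix φ x).trace = ∑ i, ‖φ (x i)‖ ^ 2 := by
    simp only [Matrix.trace, kernelMatrix, Matrix.diag_apply, Matrix.of_apply,
      real_inner_self_eq_norm_sq]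
  rw [htr, norm_smul, Real.norm_of_nonneg (Real.sqrt_nonneg _), mul_comm _ ‖w‖, mul_assoc]
  refine mul_le_mul_of_nonneg_left ?_ (norm_nonneg w)
  have h0 : 0 ≤ ∑ i, ‖φ (x i)‖ ^ 2 := Finset.sum_nonneg fun _ _ => sq_nonneg _
  rw [← Real.sqrt_mul (by positivity)]
  refine Real.sqrt_le_sqrt ?_
  rcases h0.eq_or_lt with h | h
  -- When all training features vanish, `N / 0 = 0` and both roots are zero.
  · rw [← h]; simp
  · rw [div_mul_cancel₀ _ h.ne']

lemma abs_clip_sub_clip_le (a b : ℝ) : |min 1 (max (-1) a) - min 1 (max (-1) b)| ≤ |a - b| := by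
  refine (abs_min_sub_min_le_max _ _ _ _).trans ?_
  rw [sub_self, abs_zero]
  refine max_le (abs_nonneg _) ((abs_max_sub_max_le_max _ _ _ _).trans ?_)
  rw [sub_self, abs_zero]
  exact max_le (abs_nonneg _) le_rfl

lemma clip_mem (a : ℝ) : |min 1 (max (-1) a)| ≤ 1 := by
  rw [abs_le]
  exact ⟨le_min (by norm_num) (le_max_left _ _), min_le_left _ _⟩

lemma clip_eq_self {a : ℝ} (h : |a| ≤ 1) : min 1 (max (-1) a) = a := by
  rw [max_eq_right (abs_le.1 h).1, min_eq_right (abs_le.1 h).2]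

variable [MeasurableSpace X]

/-- The generalisation error of the trained model is controlled by the norm of its weight. -/
theorem measure_generalisation_gap_le (D : Measure X) [IsProbabilityMeasure D] (φ : X → H)
    (hφ : Measurable fun p : X × X => ⟪φ p.1, φ p.2⟫_ℝ) {q : X → ℝ} (hq : Measurable q)
    (hq1 : ∀ z, |q z| ≤ 1) (hN : 0 < N) (l : ℝ) {s : ℝ} (hs : 32 * √N ≤ s) :
    Measure.pi (fun _ : Fin N => D)
      {x | 16 * (‖trainedWeight (rescale φ x) l x fun i => q (x i)‖ * √N) + 2 * s
        < N * (∫ z, |prediction (rescale φ x) l x (fun i => q (x i)) z - q z| ∂D)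
          - ∑ i, |prediction (rescale φ x) l x (fun i => q (x i)) (x i) - q (x i)|}
      ≤ 2 * ENNReal.ofReal (3 * Real.exp (-(s ^ 2 / (128 * N)))) := by
  classical
  have hN' : (0 : ℝ) < N := Nat.cast_pos.2 hN
  have hr : 0 < √(N : ℝ) := Real.sqrt_pos.2 hN'
  have hk : ∀ i j, Measurable fun x : Fin N → X => ⟪φ (x i), φ (x j)⟫_ℝ := fun i j =>
    Measurable.comp (f := fun x : Fin N → X => (x i, x j)) hφ
      ((measurable_pi_apply i).prodMk (measurable_pi_apply j))
  have htr : Measurable fun x : Fin N → X => (kernelMatrix φ x).trace :=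
    Finset.measurable_sum _ fun i _ => hk i i
  have hc : Measurable fun x : Fin N → X => √((N : ℝ) / (kernelMatrix φ x).trace) :=
    (measurable_const.div htr).sqrt
  have hK : ∀ i j, Measurable fun x : Fin N → X => kernelMatrix (rescale φ x) x i j := by
    intro i j
    simp only [kernelMatrix, Matrix.of_apply, rescale, real_inner_smul_left,
      real_inner_smul_right]
    exact hc.mul (hc.mul (hk i j))
  have hqi : ∀ i : Fin N, Measurable fun x : Fin N → X => q (x i) := fun i =>
    hq.comp (measurable_pi_apply i)
  have ha : ∀ i, Measurable fun x : Fin N → X =>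
      ((ridge (kernelMatrix (rescale φ x) x) l)⁻¹ *ᵥ fun j => q (x j)) i := by
    intro i
    have hR : ∀ i j, Measurable fun x : Fin N → X =>
        ridge (kernelMatrix (rescale φ x) x) l i j := fun i j => (hK i j).add measurable_const
    simp only [mulVec, dotProduct]
    exact Finset.measurable_sum _ fun j _ => (measurable_inv_apply hR i j).mul (hqi j)
  have hw : Measurable fun x : Fin N → X =>
      ‖trainedWeight (rescale φ x) l x fun i => q (x i)‖ := by
    have e : ∀ x : Fin N → X, ‖trainedWeight (rescale φ x) l x fun i => q (x i)‖
        = √(∑ i, ((ridge (kernelMatrix (rescale φ x) x) l)⁻¹ *ᵥ fun j => q (x j)) i *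
          ∑ j, kernelMatrix (rescale φ x) x i j *
            ((ridge (kernelMatrix (rescale φ x) x) l)⁻¹ *ᵥ fun j => q (x j)) j) := fun x => by
      rw [← Real.sqrt_sq (norm_nonneg (trainedWeight (rescale φ x) l x fun i => q (x i))),
        trainedWeight_eq, norm_sum_smul_feature_sq]
      rfl
    simp only [e]
    exact (Finset.measurable_sum _ fun i _ => (ha i).mul
      (Finset.measurable_sum _ fun j _ => (hK i j).mul (ha j))).sqrt
  have hpred : Measurable (Function.uncurry fun (x : Fin N → X) z =>
      |prediction (rescale φ x) l x (fun i => q (x i)) z - q z|) := by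
    have e : ∀ (x : Fin N → X) z, ⟪trainedWeight (rescale φ x) l x fun i => q (x i),
        rescale φ x z⟫_ℝ = ∑ i, ((ridge (kernelMatrix (rescale φ x) x) l)⁻¹ *ᵥ
          fun j => q (x j)) i * (√((N : ℝ) / (kernelMatrix φ x).trace) *
            (√((N : ℝ) / (kernelMatrix φ x).trace) * ⟪φ (x i), φ z⟫_ℝ)) := fun x z => by
      rw [trainedWeight_eq, sum_inner]
      simp only [rescale, real_inner_smul_left, real_inner_smul_right]
      exact Finset.sum_congr rfl fun i _ => by ring
    unfold Function.uncurry prediction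
    simp only [e]
    have hkz : ∀ i, Measurable fun p : (Fin N → X) × X => ⟪φ (p.1 i), φ p.2⟫_ℝ := fun i =>
      Measurable.comp (f := fun p : (Fin N → X) × X => (p.1 i, p.2)) hφ
        (((measurable_pi_apply i).comp measurable_fst).prodMk measurable_snd)
    have hc' : Measurable fun p : (Fin N → X) × X => √((N : ℝ) / (kernelMatrix φ p.1).trace) :=
      hc.comp measurable_fst
    refine ((measurable_const.min (measurable_const.max
      (Finset.measurable_sum _ fun i _ => ((ha i).comp measurable_fst).mul
        (hc'.mul (hc'.mul (hkz i)))))).sub (hq.comp measurable_snd)).abs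
  refine measure_deviation_le_of_card_swap_le D
    (h := fun x z => |prediction (rescale φ x) l x (fun i => q (x i)) z - q z|)
    (pen := fun x => 16 * (‖trainedWeight (rescale φ x) l x fun i => q (x i)‖ * √N))
    hpred (fun _ _ => abs_nonneg _) ?_ ((hw.mul_const _).const_mul _) (by linarith [hr]) ?_ ?_
  · intro x z
    refine (abs_sub _ _).trans ?_
    have h1 : |prediction (rescale φ x) l x (fun i => q (x i)) z| ≤ 1 := clip_mem _
    linarith [hq1 z]
  · have := Real.sq_sqrt hN'.le
    nlinarith
  · intro P
    set z : Bool → Fin N → X := fun b i => if b then (P i).1 else (P i).2 with hz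
    -- Once the pairs are fixed, the swap `σ` affects only this weight and the choice of which half
    -- is used for training; `σ i = true` selects the first component.
    set W : (Fin N → Bool) → H := fun σ =>
      √((N : ℝ) / (kernelMatrix φ fun i => (swapPairs σ P i).1).trace) •
        trainedWeight (rescale φ fun i => (swapPairs σ P i).1) l (fun i => (swapPairs σ P i).1)
          fun i => q (swapPairs σ P i).1 with hW
    have h1 : ∀ σ i, (swapPairs σ P i).1 = z (σ i) i := fun σ i => by
      simp only [swapPairs, hz]; cases σ i <;> rfl
    have h2 : ∀ σ i, (swapPairs σ P i).2 = z (!σ i) i := fun σ i => by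
      simp only [swapPairs, hz]; cases σ i <;> rfl
    refine card_swap_deviation_le hN W (fun b i => φ (z b i))
      (fun b i v => |min 1 (max (-1) ⟪v, φ (z b i)⟫_ℝ) - q (z b i)|)
      (fun _ _ _ => abs_nonneg _)
      (fun b i v => (abs_sub _ _).trans (by
        linarith [clip_mem ⟪v, φ (z b i)⟫_ℝ, hq1 (z b i)]))
      (fun b i v v' => (abs_abs_sub_abs_le_abs_sub _ _).trans (by
        rw [sub_sub_sub_cancel_right]; exact abs_clip_sub_clip_le _ _)) hs _ ?_
    intro σ hσ
    have h3 := norm_rescaled_weight_mul_le φ (fun i => (swapPairs σ P i).1)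
      (trainedWeight (rescale φ fun i => (swapPairs σ P i).1) l (fun i => (swapPairs σ P i).1)
          fun i => q (swapPairs σ P i).1)
    have h4 : 16 * (‖W σ‖ * √(∑ i, ‖φ (z (σ i) i)‖ ^ 2)) + s
        ≤ 16 * (‖trainedWeight (rescale φ fun i => (swapPairs σ P i).1) l
          (fun i => (swapPairs σ P i).1) fun i => q (swapPairs σ P i).1‖ * √N) + s := by
      simp only [← h1]
      linarith
    refine h4.trans_lt (hσ.trans_le (le_of_eq ?_))
    rw [← Finset.sum_sub_distrib]
    refine Finset.sum_congr rfl fun i _ => ?_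
    simp only [prediction, trainedWeight_rescale_inner]
    rw [h2 σ i, h1 σ i]
    change |min 1 (max (-1) ⟪W σ, φ (z (!σ i) i)⟫_ℝ) - q (z (!σ i) i)|
      - |min 1 (max (-1) ⟪W σ, φ (z (σ i) i)⟫_ℝ) - q (z (σ i) i)| = _
    cases σ i
    · simp
    · simp

end Generalisation

end KernelML

namespace KernelML

/-! ### Hilbert–Schmidt features and the representer of the quantum model -/

section QuantumFeatures

variable {m : ℕ}

/-- A complex matrix as a vector of the Hilbert–Schmidt space. -/
def vecMatrix (A : Matrix (Fin m) (Fin m) ℂ) : EuclideanSpace ℂ (Fin m × Fin m) :=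
  WithLp.toLp 2 fun p => A p.1 p.2

lemma inner_vecMatrix (A B : Matrix (Fin m) (Fin m) ℂ) :
    ⟪vecMatrix A, vecMatrix B⟫_ℝ = (Aᴴ * B).trace.re := by
  rw [PiLp.inner_apply, Fintype.sum_prod_type, Finset.sum_comm]
  simp only [Matrix.trace, Matrix.diag_apply, Matrix.mul_apply, conjTranspose_apply, vecMatrix,
    Complex.inner, Complex.re_sum]
  exact Finset.sum_congr rfl fun i _ => Finset.sum_congr rfl fun j _ => by rw [mul_comm]; rfl

lemma norm_vecMatrix_sq (A : Matrix (Fin m) (Fin m) ℂ) :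
    ‖vecMatrix A‖ ^ 2 = (Aᴴ * A).trace.re := by
  rw [← real_inner_self_eq_norm_sq, inner_vecMatrix]

lemma vecMatrix_sum_smul {ι : Type*} (s : Finset ι) (c : ι → ℝ)
    (A : ι → Matrix (Fin m) (Fin m) ℂ) :
    vecMatrix (∑ i ∈ s, c i • A i) = ∑ i ∈ s, c i • vecMatrix (A i) := by
  ext p
  simp [vecMatrix, Matrix.sum_apply]

lemma pureState_eq_vecMulVec (ψ : EuclideanSpace ℂ (Fin m)) :
    pureState ψ = vecMulVec ψ.ofLp (star ψ.ofLp) := by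
  ext a b; rfl

lemma pureState_isHermitian (ψ : EuclideanSpace ℂ (Fin m)) : (pureState ψ).IsHermitian := by
  ext a b
  simp [pureState, conjTranspose_apply, mul_comm]

lemma abs_re_star_dotProduct_mulVec_le (A : Matrix (Fin m) (Fin m) ℂ) (u : Fin m → ℂ) :
    |(star u ⬝ᵥ A *ᵥ u).re| ≤ ‖A‖ * (star u ⬝ᵥ u).re := by
  have h1 : (star u ⬝ᵥ A *ᵥ u).re ≤ _ := re_star_dotProduct_mulVec_le A u
  have h2 : (star u ⬝ᵥ (-A) *ᵥ u).re ≤ _ := re_star_dotProduct_mulVec_le (-A) u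
  rw [neg_mulVec, dotProduct_neg, Complex.neg_re, norm_neg] at h2
  exact abs_le.2 ⟨by simp only [RCLike.re_to_complex] at h2; linarith, h1⟩

lemma norm_conj_unitary (O : Matrix (Fin m) (Fin m) ℂ) {U : Matrix (Fin m) (Fin m) ℂ}
    (hU : U ∈ Matrix.unitaryGroup (Fin m) ℂ) : ‖Uᴴ * O * U‖ = ‖O‖ := by
  have hU' : Uᴴ ∈ unitary (Matrix (Fin m) (Fin m) ℂ) := Unitary.star_mem hU
  rw [CStarRing.norm_mul_mem_unitary _ hU, CStarRing.norm_mem_unitary_mul _ hU']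

lemma abs_quantumModel_le {O U : Matrix (Fin m) (Fin m) ℂ} (hO : ‖O‖ ≤ 1)
    (hU : U ∈ Matrix.unitaryGroup (Fin m) ℂ) {ψ : EuclideanSpace ℂ (Fin m)} (hψ : ‖ψ‖ = 1) :
    |quantumModel O U ψ| ≤ 1 := by
  have e : (Uᴴ * O * U * pureState ψ).trace = star ψ.ofLp ⬝ᵥ (Uᴴ * O * U) *ᵥ ψ.ofLp := by
    rw [pureState_eq_vecMulVec, mul_vecMulVec, trace_vecMulVec, dotProduct_comm]
  have hn : (star ψ.ofLp ⬝ᵥ ψ.ofLp).re = 1 := by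
    have := re_star_dotProduct_self ψ.ofLp
    rw [← EuclideanSpace.norm_sq_eq, hψ, one_pow] at this
    exact this
  rw [quantumModel, e]
  refine (abs_re_star_dotProduct_mulVec_le _ _).trans ?_
  rw [hn, mul_one, norm_conj_unitary O hU]
  exact hO

lemma continuous_quantumModel (O U : Matrix (Fin m) (Fin m) ℂ) :
    Continuous fun ψ : EuclideanSpace ℂ (Fin m) => quantumModel O U ψ := by
  unfold quantumModel Matrix.trace
  simp only [Matrix.diag_apply, Matrix.mul_apply, pureState, Matrix.of_apply]
  fun_prop

/-- The Hilbert–Schmidt pairing with a contraction is at most `√(rank)` times the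
Hilbert–Schmidt norm. -/
lemma re_trace_mul_sq_le {A B : Matrix (Fin m) (Fin m) ℂ} (hA : ‖A‖ ≤ 1) (hB : B.IsHermitian)
    {d : ℕ} (hd : B.rank ≤ d) : (A * B).trace.re ^ 2 ≤ d * (B * B).trace.re := by
  -- In an orthonormal eigenbasis of `B` the trace is a sum of eigenvalues weighted by diagonal
  -- entries of `A`. These are at most 1 in absolute value and at most `d` eigenvalues are nonzero,
  -- so Cauchy–Schwarz finishes.
  set V : Matrix (Fin m) (Fin m) ℂ := (hB.eigenvectorUnitary : Matrix (Fin m) (Fin m) ℂ) with hV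
  set D : Matrix (Fin m) (Fin m) ℂ := diagonal (RCLike.ofReal ∘ hB.eigenvalues) with hD
  have hVU : V ∈ Matrix.unitaryGroup (Fin m) ℂ := hB.eigenvectorUnitary.2
  have hsp : B = V * D * Vᴴ := by
    conv_lhs => rw [hB.spectral_theorem, Unitary.conjStarAlgAut_apply]
    rfl
  have hVV : Vᴴ * V = 1 := (Matrix.mem_unitaryGroup_iff').1 hVU
  have h1 : (A * B).trace.re = ∑ k, ((Vᴴ * A * V) k k).re * hB.eigenvalues k := by
    have : (A * B).trace = (Vᴴ * A * V * D).trace := by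
      conv_lhs => rw [hsp, ← Matrix.mul_assoc, Matrix.trace_mul_comm]
      simp only [Matrix.mul_assoc]
    rw [this, Matrix.trace, Complex.re_sum]
    refine Finset.sum_congr rfl fun k _ => ?_
    rw [Matrix.diag_apply, hD, Matrix.mul_diagonal, Function.comp_apply]
    exact Complex.re_mul_ofReal _ _
  have h2 : (B * B).trace.re = ∑ k, hB.eigenvalues k ^ 2 := by
    have : (B * B).trace = (D * D).trace := by
      conv_lhs => rw [hsp]
      rw [show V * D * Vᴴ * (V * D * Vᴴ) = V * D * (Vᴴ * V) * D * Vᴴ by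
        simp only [Matrix.mul_assoc], hVV, Matrix.mul_one, Matrix.trace_mul_comm,
        Matrix.mul_assoc, ← Matrix.mul_assoc, hVV, Matrix.one_mul]
    rw [this, hD, Matrix.diagonal_mul_diagonal, Matrix.trace_diagonal, Complex.re_sum]
    refine Finset.sum_congr rfl fun k _ => ?_
    simp only [Function.comp_apply]
    rw [sq]
    exact (Complex.re_ofReal_mul _ _).trans rfl
  have h3 : ∀ k, |((Vᴴ * A * V) k k).re| ≤ 1 := by
    intro k
    have h := abs_re_star_dotProduct_mulVec_le (Vᴴ * A * V) (Pi.single k 1)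
    have e1 : star (Pi.single k 1 : Fin m → ℂ) = Pi.single k 1 := by
      rw [Pi.star_single, star_one]
    rw [e1, Matrix.mulVec_single_one, single_one_dotProduct, single_one_dotProduct,
      Pi.single_eq_same, Complex.one_re, mul_one, norm_conj_unitary A hVU] at h
    exact h.trans hA
  classical
  set S := Finset.univ.filter fun k => hB.eigenvalues k ≠ 0 with hS
  have hcard : S.card ≤ d := by
    rw [hB.rank_eq_card_non_zero_eigs, Fintype.card_subtype] at hd
    exact hd
  have hzero : ∀ f : Fin m → ℝ, ∑ k, f k * hB.eigenvalues k
      = ∑ k ∈ S, f k * hB.eigenvalues k := fun f => by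
    rw [hS, Finset.sum_filter_of_ne]
    intro k _ hk h0
    rw [h0, mul_zero] at hk
    exact hk rfl
  rw [h1, h2, hzero]
  calc _ ≤ (∑ k ∈ S, ((Vᴴ * A * V) k k).re ^ 2) * ∑ k ∈ S, hB.eigenvalues k ^ 2 :=
        Finset.sum_mul_sq_le_sq_mul_sq _ _ _
    _ ≤ d * ∑ k, hB.eigenvalues k ^ 2 := by
        refine mul_le_mul ?_ ?_ (Finset.sum_nonneg fun _ _ => sq_nonneg _) (Nat.cast_nonneg _)
        · calc _ ≤ ∑ k ∈ S, (1 : ℝ) :=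
                Finset.sum_le_sum fun k _ => (sq_le_one_iff_abs_le_one _).2 (h3 k)
            _ ≤ d := by simpa using hcard
        · exact Finset.sum_le_sum_of_subset_of_nonneg (Finset.subset_univ _)
            fun _ _ _ => sq_nonneg _

/-- The sum factors through a space of dimension `d`. -/
lemma rank_sum_smul_pureState_le {d : ℕ} (c : Fin d → ℝ) (ψ : Fin d → EuclideanSpace ℂ (Fin m)) :
    (∑ k, c k • pureState (ψ k)).rank ≤ d := by
  have e : ∑ k, c k • pureState (ψ k)
      = (Matrix.of fun a k => (c k : ℂ) * ψ k a) * Matrix.of fun k b => star (ψ k b) := by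
    ext a b
    simp [Matrix.sum_apply, Matrix.mul_apply, pureState, mul_assoc]
  rw [e]
  exact (Matrix.rank_mul_le_left _ _).trans ((Matrix.rank_le_width _))

variable {X : Type*} {N : ℕ}

/-- The Hilbert–Schmidt feature map of an encoding into pure states. -/
def stateFeature (ψ : X → EuclideanSpace ℂ (Fin m)) : X → EuclideanSpace ℂ (Fin m × Fin m) :=
  fun z => vecMatrix (pureState (ψ z))

lemma kernelMatrix_stateFeature (ψ : X → EuclideanSpace ℂ (Fin m)) (x : Fin N → X) :
    kernelMatrix (stateFeature ψ) x = quantumKernelMatrix ψ x := by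
  ext i j
  simp only [kernelMatrix, quantumKernelMatrix, Matrix.of_apply, stateFeature, inner_vecMatrix,
    (pureState_isHermitian _).eq]

/-- On the training inputs, the quantum model is represented by a vector whose squared norm is at
most the dimension of the span of the training states and the squared Hilbert–Schmidt norm of the
observable. -/
lemma exists_representer {O U : Matrix (Fin m) (Fin m) ℂ} (hO : O.IsHermitian) (hO1 : ‖O‖ ≤ 1)
    (hU : U ∈ Matrix.unitaryGroup (Fin m) ℂ) (ψ : X → EuclideanSpace ℂ (Fin m)) (x : Fin N → X) :
    ∃ w : EuclideanSpace ℂ (Fin m × Fin m),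
      (∀ i, ⟪w, stateFeature ψ (x i)⟫_ℝ = quantumModel O U (ψ (x i))) ∧
        ‖w‖ ^ 2 ≤ min (trainingDim ψ x : ℝ) (O * O).trace.re := by
  set A := Uᴴ * O * U with hA
  have hAH : A.IsHermitian := Matrix.isHermitian_conjTranspose_mul_mul U hO
  have hq : ∀ z, ⟪vecMatrix A, stateFeature ψ z⟫_ℝ = quantumModel O U (ψ z) := fun z => by
    rw [stateFeature, inner_vecMatrix, hAH.eq]; rfl
  obtain ⟨c, hc, hle⟩ := exists_mulVec_kernelMatrix_eq (stateFeature ψ) x (vecMatrix A)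
  set B := ∑ i, c i • pureState (ψ (x i)) with hB
  have hBv : vecMatrix B = ∑ i, c i • stateFeature ψ (x i) := vecMatrix_sum_smul _ _ _
  have hBH : B.IsHermitian := by
    rw [Matrix.IsHermitian, hB, Matrix.conjTranspose_sum]
    refine Finset.sum_congr rfl fun i _ => ?_
    rw [Matrix.conjTranspose_smul, (pureState_isHermitian _).eq, star_trivial]
  have hrep : ∀ i, ⟪vecMatrix B, stateFeature ψ (x i)⟫_ℝ
      = ⟪vecMatrix A, stateFeature ψ (x i)⟫_ℝ := fun i => by
    rw [hBv, inner_sum_smul_feature]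
    exact (congrFun hc i).symm
  rw [← norm_sum_smul_feature_sq, ← hBv] at hle
  refine ⟨vecMatrix B, fun i => (hrep i).trans (hq _), le_min ?_ ?_⟩
  -- `A - B` is orthogonal to every training state, hence to `B` itself.
  · have hAB : (A * B).trace.re = ‖vecMatrix B‖ ^ 2 := by
      have h1 : ⟪vecMatrix A, vecMatrix B⟫_ℝ = ⟪vecMatrix B, vecMatrix B⟫_ℝ := by
        conv_lhs => rw [hBv, inner_sum]
        conv_rhs => rw [hBv, inner_sum, ← hBv]
        refine Finset.sum_congr rfl fun i _ => ?_
        rw [real_inner_smul_right, real_inner_smul_right, hrep]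
      rw [← real_inner_self_eq_norm_sq, ← h1, inner_vecMatrix, hAH.eq]
    have hBB : (B * B).trace.re = ‖vecMatrix B‖ ^ 2 := by
      rw [norm_vecMatrix_sq, hBH.eq]
    -- A spanning family of `d` members can be chosen among the training states themselves, so `B`
    -- is a combination of `d` rank-one matrices, whatever `N` is.
    have hrank : B.rank ≤ trainingDim ψ x := by
      set R := Set.range fun i => pureState (ψ (x i)) with hR
      have : Module.Finite ℝ (Submodule.span ℝ R) :=
        FiniteDimensional.span_of_finite ℝ (Set.finite_range _)
      obtain ⟨f, hf, hspan, -⟩ := Submodule.exists_fun_fin_finrank_span_eq ℝ R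
      choose k hk using hf
      have hmem : B ∈ Submodule.span ℝ (Set.range f) := by
        rw [hspan]
        exact Submodule.sum_mem _ fun i _ =>
          Submodule.smul_mem _ _ (Submodule.subset_span ⟨i, rfl⟩)
      obtain ⟨a, ha⟩ := (Submodule.mem_span_range_iff_exists_fun ℝ).1 hmem
      rw [← ha]
      simp only [← hk]
      exact rank_sum_smul_pureState_le a fun j => ψ (x (k j))
    have hA1 : ‖A‖ ≤ 1 := (norm_conj_unitary O hU).le.trans hO1
    have h := re_trace_mul_sq_le hA1 hBH hrank
    rw [hAB, hBB, sq (‖vecMatrix B‖ ^ 2)] at h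
    rcases (sq_nonneg ‖vecMatrix B‖).eq_or_lt with h0 | h0
    · rw [← h0]; exact Nat.cast_nonneg _
    · exact le_of_mul_le_mul_right h h0
  · refine hle.trans (le_of_eq ?_)
    have hUU : U * Uᴴ = 1 := Matrix.mem_unitaryGroup_iff.1 hU
    rw [norm_vecMatrix_sq, hAH.eq, hA]
    congr 1
    rw [show Uᴴ * O * U * (Uᴴ * O * U) = Uᴴ * (O * (U * Uᴴ) * O * U) by
      simp only [Matrix.mul_assoc], hUU, Matrix.mul_one, Matrix.trace_mul_comm, Matrix.mul_assoc,
      hUU, Matrix.mul_one]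

end QuantumFeatures

end KernelML

namespace KernelML

/-! ### Prediction error bounds -/

section PredictionError

/-- Since `log (1 / δ) ≥ log (1 / δ₀) > 0`, additive constants are absorbed into a multiple of `log
(1 / δ)`. The choice of `c` makes `c² log (1 / δ) / 128` at least `log (1 / δ) + 8`: the 8 yields
the threshold 32, as `128 · 8 = 32²`, and absorbs the prefactor 6, as `6 exp (-8) ≤ 1`. -/
lemma exists_deviation_constant {δ₀ : ℝ} (hδ₀ : δ₀ < 1) : ∃ c : ℝ, 0 < c ∧
    ∀ (N : ℕ) (δ : ℝ), 0 < N → 0 < δ → δ ≤ δ₀ →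
      32 * √N ≤ c * √(N * Real.log (1 / δ)) ∧
      2 * ENNReal.ofReal (3 * Real.exp (-((c * √(N * Real.log (1 / δ))) ^ 2 / (128 * N))))
        ≤ ENNReal.ofReal δ := by
  by_cases h0 : 0 < δ₀
  swap
  · exact ⟨1, one_pos, fun N δ _ h1 h2 => absurd (h1.trans_le h2) h0⟩
  have hl0 : 0 < Real.log (1 / δ₀) := Real.log_pos ((one_lt_div h0).2 hδ₀)
  set l₀ := Real.log (1 / δ₀) with hl₀
  set c := √(128 * (1 + 8 / l₀)) with hc
  have hc2 : c ^ 2 = 128 * (1 + 8 / l₀) := Real.sq_sqrt (by positivity)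
  have hcpos : 0 < c := Real.sqrt_pos.2 (by positivity)
  refine ⟨c, hcpos, fun N δ hN hδ hle => ?_⟩
  have hN' : (0 : ℝ) < N := Nat.cast_pos.2 hN
  set ℓ := Real.log (1 / δ) with hℓ
  have hℓ0 : l₀ ≤ ℓ := Real.log_le_log (by positivity) (one_div_le_one_div_of_le hδ hle)
  have hc3 : 128 * (ℓ + 8) ≤ c ^ 2 * ℓ := by
    have : 1 ≤ ℓ / l₀ := (one_le_div hl0).2 hℓ0
    have e : c ^ 2 * ℓ = 128 * (ℓ + 8 * (ℓ / l₀)) := by rw [hc2]; ring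
    rw [e]; linarith
  have hℓpos : 0 < ℓ := hl0.trans_le hℓ0
  constructor
  · rw [Real.sqrt_mul hN'.le, mul_left_comm, mul_comm 32]
    refine mul_le_mul_of_nonneg_left ?_ (Real.sqrt_nonneg _)
    refine abs_le_of_sq_le_sq' (a := 32) ?_ (by positivity) |>.2
    rw [mul_pow, Real.sq_sqrt hℓpos.le]
    linarith
  · rw [← ENNReal.ofReal_ofNat 2, ← ENNReal.ofReal_mul (by norm_num)]
    refine ENNReal.ofReal_le_ofReal ?_
    have e1 : (c * √(N * ℓ)) ^ 2 / (128 * N) = c ^ 2 * ℓ / 128 := by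
      rw [mul_pow, Real.sq_sqrt (mul_nonneg hN'.le hℓpos.le)]; field_simp
    rw [e1]
    have hδe : Real.exp (-ℓ) = δ := by
      rw [hℓ, one_div, Real.log_inv, neg_neg, Real.exp_log hδ]
    have e2 : Real.exp (-(c ^ 2 * ℓ / 128)) ≤ δ * Real.exp (-8) := by
      rw [← hδe, ← Real.exp_add]
      exact Real.exp_le_exp.2 (by linarith)
    have e3 : Real.exp (-8) ≤ 1 / 8 := by
      rw [Real.exp_neg, one_div]
      exact inv_anti₀ (by norm_num) (by linarith [Real.add_one_le_exp (8 : ℝ)])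
    nlinarith

variable {X : Type*} {H : Type*} [NormedAddCommGroup H] [InnerProductSpace ℝ H] {m N : ℕ}

/-- A deterministic bound: the prediction error of a well-behaved sample. -/
lemma predictionError_le [MeasurableSpace X] (D : Measure X) (φ : X → H)
    (ψ : X → EuclideanSpace ℂ (Fin m)) {O U : Matrix (Fin m) (Fin m) ℂ} (hψ : ∀ z, ‖ψ z‖ = 1)
    (hO : O.IsHermitian) (hO1 : ‖O‖ ≤ 1) (hU : U ∈ Matrix.unitaryGroup (Fin m) ℂ) (hN : 0 < N)
    {l : ℝ} (hl : 0 ≤ l) (x : Fin N → X) (hu : IsUnit (ridge (kernelMatrix φ x) l).det) {s : ℝ}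
    (hgap : N * predictionError D O U ψ φ l x
        - ∑ i, |prediction φ l x (fun i => quantumModel O U (ψ (x i))) (x i)
            - quantumModel O U (ψ (x i))|
      ≤ 16 * (‖trainedWeight φ l x fun i => quantumModel O U (ψ (x i))‖ * √N) + 2 * s) :
    predictionError D O U ψ φ l x
      ≤ (geomDiffTra (kernelMatrix φ x) (quantumKernelMatrix ψ x) l
          + 16 * geomDiffGen (kernelMatrix φ x) (quantumKernelMatrix ψ x) l)
        * √(min (trainingDim ψ x : ℝ) (O * O).trace.re / N) + 2 * s / N := by
  have hN' : (0 : ℝ) < N := Nat.cast_pos.2 hN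
  have hr : 0 < √(N : ℝ) := Real.sqrt_pos.2 hN'
  have hrr : √(N : ℝ) * √N = N := Real.mul_self_sqrt hN'.le
  obtain ⟨w, hw, hw2⟩ := exists_representer hO hO1 hU ψ x
  set M := min (trainingDim ψ x : ℝ) (O * O).trace.re
  set gt := geomDiffTra (kernelMatrix φ x) (quantumKernelMatrix ψ x) l with hgt
  set gg := geomDiffGen (kernelMatrix φ x) (quantumKernelMatrix ψ x) l with hgg
  have hgt0 : 0 ≤ gt := mul_nonneg hl (Real.sqrt_nonneg _)
  have hgg0 : 0 ≤ gg := Real.sqrt_nonneg _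
  have hwM : ‖w‖ ≤ √M := Real.le_sqrt_of_sq_le hw2
  have hy : (fun i => quantumModel O U (ψ (x i))) = fun i => ⟪w, stateFeature ψ (x i)⟫_ℝ :=
    funext fun i => (hw i).symm
  have hnorm : ‖trainedWeight φ l x fun i => quantumModel O U (ψ (x i))‖ ≤ gg * √M := by
    have h := norm_trainedWeight_sq_le (stateFeature ψ) φ x w hu
    rw [kernelMatrix_stateFeature, ← hgg, ← hy, ← mul_pow] at h
    exact (abs_le_of_sq_le_sq' h (by positivity)).2.trans (by gcongr)
  have hres : ∑ i, (⟪trainedWeight φ l x (fun i => quantumModel O U (ψ (x i))), φ (x i)⟫_ℝ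
      - quantumModel O U (ψ (x i))) ^ 2 ≤ (gt * √M) ^ 2 := by
    have h := sum_residual_trainedWeight_sq_le (stateFeature ψ) φ x w hu
    rw [kernelMatrix_stateFeature, ← hgt, ← hy, ← mul_pow] at h
    simp only [hw] at h
    exact h.trans (by gcongr)
  -- Clipping is 1-Lipschitz and fixes the labels, so it only shrinks residuals; Cauchy–Schwarz then
  -- passes from squares to absolute values.
  have hemp : ∑ i, |prediction φ l x (fun i => quantumModel O U (ψ (x i))) (x i)
      - quantumModel O U (ψ (x i))| ≤ √N * (gt * √M) := by
    have h1 : ∀ i, |prediction φ l x (fun i => quantumModel O U (ψ (x i))) (x i)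
        - quantumModel O U (ψ (x i))|
        ≤ |⟪trainedWeight φ l x (fun i => quantumModel O U (ψ (x i))), φ (x i)⟫_ℝ
          - quantumModel O U (ψ (x i))| := fun i => by
      have h := abs_clip_sub_clip_le
        ⟪trainedWeight φ l x (fun i => quantumModel O U (ψ (x i))), φ (x i)⟫_ℝ
        (quantumModel O U (ψ (x i)))
      rwa [clip_eq_self (abs_quantumModel_le hO1 hU (hψ (x i)))] at h
    refine (Finset.sum_le_sum fun i _ => h1 i).trans ?_
    refine (abs_le_of_sq_le_sq' ?_ (by positivity)).2
    refine sq_sum_le_card_mul_sum_sq.trans ?_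
    rw [Finset.card_univ, Fintype.card_fin, mul_pow, Real.sq_sqrt hN'.le]
    refine mul_le_mul_of_nonneg_left ?_ hN'.le
    simpa only [sq_abs] using hres
  have h1 : N * predictionError D O U ψ φ l x
      ≤ √N * (gt * √M) + 16 * (gg * √M * √N) + 2 * s := by
    have := mul_le_mul_of_nonneg_right hnorm hr.le
    linarith
  have h2 : √(M / N) = √M * √N / N := by
    rw [Real.sqrt_div' _ hN'.le, div_eq_div_iff hr.ne' hN'.ne', mul_assoc, hrr]
  rw [h2, ← mul_div_assoc, ← add_div, le_div_iff₀ hN']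
  linarith

/-- The prediction error bound relative to the quantum kernel, for samples whose regularised
kernel matrix is invertible. -/
theorem exists_predictionError_constant {δ₀ : ℝ} (hδ₀ : δ₀ < 1) : ∃ C : ℝ, 0 < C ∧
    ∀ (X : Type*) [MeasurableSpace X] (D : Measure X) [IsProbabilityMeasure D]
      (H : Type*) [NormedAddCommGroup H] [InnerProductSpace ℝ H] (φ : X → H)
      (m : ℕ) (ψ : X → EuclideanSpace ℂ (Fin m)) (O U : Matrix (Fin m) (Fin m) ℂ)
      (N : ℕ) (l δ : ℝ),
      Measurable (fun p : X × X => ⟪φ p.1, φ p.2⟫_ℝ) →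
      Measurable ψ → (∀ z, ‖ψ z‖ = 1) →
      O.IsHermitian → ‖O‖ ≤ 1 → U ∈ Matrix.unitaryGroup (Fin m) ℂ →
      0 < N → 0 ≤ l → 0 < δ → δ ≤ δ₀ →
      Measure.pi (fun _ : Fin N => D)
        {x | IsUnit (ridge (kernelMatrix (rescale φ x) x) l).det ∧
          ¬ predictionError D O U ψ (rescale φ x) l x ≤
            C * ((geomDiffTra (kernelMatrix (rescale φ x) x) (quantumKernelMatrix ψ x) l
                  + geomDiffGen (kernelMatrix (rescale φ x) x) (quantumKernelMatrix ψ x) l)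
                  * √(min (trainingDim ψ x : ℝ) (O * O).trace.re / N)
                + √(Real.log (1 / δ) / N))} ≤ ENNReal.ofReal δ := by
  obtain ⟨c, hc, hcδ⟩ := exists_deviation_constant hδ₀
  -- The 16 is the coefficient of the weight norm in the generalisation gap, and `2 c` comes from
  -- the slack `2 s / N`.
  refine ⟨16 + 2 * c, by positivity, ?_⟩
  intro X _ D _ H _ _ φ m ψ O U N l δ hφ hψ hψ1 hO hO1 hU hN hl hδ hle
  have hN' : (0 : ℝ) < N := Nat.cast_pos.2 hN
  obtain ⟨hs, hp⟩ := hcδ N δ hN hδ hle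
  set s := c * √(N * Real.log (1 / δ)) with hsdef
  refine le_trans (measure_mono ?_) ((measure_generalisation_gap_le D φ hφ
    ((continuous_quantumModel O U).measurable.comp hψ)
    (fun z => abs_quantumModel_le hO1 hU (hψ1 z)) hN l hs).trans hp)
  rintro x ⟨hu, hx⟩
  rw [Set.mem_ofPred_eq]
  by_contra hcon
  rw [not_lt] at hcon
  refine hx ((predictionError_le D (rescale φ x) ψ hψ1 hO hO1 hU hN hl x hu hcon).trans ?_)
  have hgt0 : 0 ≤ geomDiffTra (kernelMatrix (rescale φ x) x) (quantumKernelMatrix ψ x) l :=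
    mul_nonneg hl (Real.sqrt_nonneg _)
  have hgg0 : 0 ≤ geomDiffGen (kernelMatrix (rescale φ x) x) (quantumKernelMatrix ψ x) l :=
    Real.sqrt_nonneg _
  have e : 2 * s / N = 2 * c * √(Real.log (1 / δ) / N) := by
    have hr : 0 < √(N : ℝ) := Real.sqrt_pos.2 hN'
    have hrr : √(N : ℝ) * √N = N := Real.mul_self_sqrt hN'.le
    rw [hsdef, Real.sqrt_mul hN'.le, Real.sqrt_div' _ hN'.le, mul_div_assoc',
      div_eq_div_iff hN'.ne' hr.ne']
    linear_combination 2 * c * √(Real.log (1 / δ)) * hrr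
  rw [e, mul_add]
  refine add_le_add ?_ (mul_le_mul_of_nonneg_right (by linarith) (Real.sqrt_nonneg _))
  rw [← mul_assoc]
  refine mul_le_mul_of_nonneg_right ?_ (Real.sqrt_nonneg _)
  nlinarith [mul_nonneg hc.le hgt0, mul_nonneg hc.le hgg0]

end PredictionError

end KernelML

/-! ### The main theorem -/

open KernelML in
theorem mainTheorem2 :
    -- the geometric inequality, for every labelling
    (∀ (𝕜 : Type) [RCLike 𝕜] (N : ℕ) (K₁ K₂ : Matrix (Fin N) (Fin N) 𝕜),
      K₁.PosDef → K₂.PosDef → ∀ y : Fin N → 𝕜,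
        modelComplexity K₁ y ≤ geomDiff K₁ K₂ ^ 2 * modelComplexity K₂ y ∧
        ∀ c : ℝ, 0 ≤ c → c * √(modelComplexity K₁ y / N) ≤
          c * geomDiff K₁ K₂ * √(modelComplexity K₂ y / N)) ∧
    -- the same with a singular reference kernel, whose complexity is the limit `l → 0`
    (∀ (𝕜 : Type) [RCLike 𝕜] (N : ℕ) (K₁ K₂ : Matrix (Fin N) (Fin N) 𝕜),
      K₁.PosDef → K₂.PosSemidef → ∀ y ∈ Set.range (fun c : Fin N → 𝕜 => K₂ *ᵥ c),
        ∃ s₂ : ℝ, Tendsto (fun l : ℝ => modelComplexityReg K₂ l y) (𝓝[>] 0) (𝓝 s₂) ∧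
          modelComplexity K₁ y ≤ geomDiff K₁ K₂ ^ 2 * s₂) ∧
    -- the prediction error bound relative to the quantum kernel
    (∀ δ₀ : ℝ, δ₀ < 1 → ∃ C : ℝ, 0 < C ∧
      ∀ (X : Type*) [MeasurableSpace X] (D : Measure X) [IsProbabilityMeasure D]
        (H : Type*) [NormedAddCommGroup H] [InnerProductSpace ℝ H] (φ : X → H)
        (m : ℕ) (ψ : X → EuclideanSpace ℂ (Fin m)) (O U : Matrix (Fin m) (Fin m) ℂ)
        (N : ℕ) (δ : ℝ),
        Measurable (fun p : X × X => ⟪φ p.1, φ p.2⟫_ℝ) →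
        Measurable ψ → (∀ z, ‖ψ z‖ = 1) →
        O.IsHermitian → ‖O‖ ≤ 1 → U ∈ Matrix.unitaryGroup (Fin m) ℂ →
        0 < N → 0 < δ → δ ≤ δ₀ →
        Measure.pi (fun _ : Fin N => D)
          {x | (kernelMatrix (rescale φ x) x).PosDef ∧
            ¬ predictionError D O U ψ (rescale φ x) 0 x ≤
              C * (geomDiff (kernelMatrix (rescale φ x) x) (quantumKernelMatrix ψ x)
                    * √(min (trainingDim ψ x : ℝ) (O * O).trace.re / N)
                  + √(Real.log (1 / δ) / N))} ≤ ENNReal.ofReal δ) ∧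
    -- the regularised inequalities, for every labelling, and their reduction at `l = 0`
    (∀ (𝕜 : Type) [RCLike 𝕜] (N : ℕ) (K₁ K₂ : Matrix (Fin N) (Fin N) 𝕜),
      K₁.PosSemidef → K₂.PosDef →
        (∀ l : ℝ, 0 < l → ∀ y : Fin N → 𝕜,
          modelComplexityReg K₁ l y ≤ geomDiffGen K₁ K₂ l ^ 2 * modelComplexity K₂ y ∧
          trainingError K₁ l y ≤ geomDiffTra K₁ K₂ l ^ 2 * modelComplexity K₂ y) ∧
        (K₁.PosDef → geomDiffGen K₁ K₂ 0 = geomDiff K₁ K₂ ∧ geomDiffTra K₁ K₂ 0 = 0)) ∧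
    -- the regularised inequalities for a function represented by a second kernel
    (∀ (X : Type*) (H₁ : Type*) [NormedAddCommGroup H₁] [InnerProductSpace ℝ H₁]
        (H₂ : Type*) [NormedAddCommGroup H₂] [InnerProductSpace ℝ H₂]
        (φ₁ : X → H₁) (φ₂ : X → H₂) (N : ℕ) (x : Fin N → X) (l : ℝ) (w : H₁), 0 < l →
        IsMinOn (ridgeLoss φ₂ l x (fun i => ⟪w, φ₁ (x i)⟫_ℝ)) Set.univ
          (trainedWeight φ₂ l x (fun i => ⟪w, φ₁ (x i)⟫_ℝ)) ∧
        ∀ v : H₂, IsMinOn (ridgeLoss φ₂ l x (fun i => ⟪w, φ₁ (x i)⟫_ℝ)) Set.univ v →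
          ‖v‖ ^ 2 ≤ geomDiffGen (kernelMatrix φ₂ x) (kernelMatrix φ₁ x) l ^ 2 * ‖w‖ ^ 2 ∧
          1 / (N : ℝ) * ∑ i, (⟪v, φ₂ (x i)⟫_ℝ - ⟪w, φ₁ (x i)⟫_ℝ) ^ 2 ≤
            geomDiffTra (kernelMatrix φ₂ x) (kernelMatrix φ₁ x) l ^ 2 * ‖w‖ ^ 2) ∧
    -- the regularised prediction error bound relative to the quantum kernel
    (∀ δ₀ : ℝ, δ₀ < 1 → ∃ C : ℝ, 0 < C ∧
      ∀ (X : Type*) [MeasurableSpace X] (D : Measure X) [IsProbabilityMeasure D]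
        (H : Type*) [NormedAddCommGroup H] [InnerProductSpace ℝ H] (φ : X → H)
        (m : ℕ) (ψ : X → EuclideanSpace ℂ (Fin m)) (O U : Matrix (Fin m) (Fin m) ℂ)
        (N : ℕ) (l δ : ℝ),
        Measurable (fun p : X × X => ⟪φ p.1, φ p.2⟫_ℝ) →
        Measurable ψ → (∀ z, ‖ψ z‖ = 1) →
        O.IsHermitian → ‖O‖ ≤ 1 → U ∈ Matrix.unitaryGroup (Fin m) ℂ →
        0 < N → 0 < l → 0 < δ → δ ≤ δ₀ →
        Measure.pi (fun _ : Fin N => D)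
          {x | ¬ predictionError D O U ψ (rescale φ x) l x ≤
              C * ((geomDiffTra (kernelMatrix (rescale φ x) x) (quantumKernelMatrix ψ x) l
                    + geomDiffGen (kernelMatrix (rescale φ x) x) (quantumKernelMatrix ψ x) l)
                    * √(min (trainingDim ψ x : ℝ) (O * O).trace.re / N)
                  + √(Real.log (1 / δ) / N))} ≤ ENNReal.ofReal δ) := by
  refine ⟨?_, ?_, ?_, ?_, ?_, ?_⟩
  · intro 𝕜 _ N K₁ K₂ h₁ h₂ y
    have key : modelComplexity K₁ y ≤ geomDiff K₁ K₂ ^ 2 * modelComplexity K₂ y := by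
      obtain ⟨c, rfl⟩ := exists_mulVec_eq h₂ y
      rw [modelComplexity_mulVec h₂]
      exact modelComplexity_mulVec_le h₂.posSemidef c
    refine ⟨key, fun c hc => ?_⟩
    rw [mul_assoc]
    refine mul_le_mul_of_nonneg_left ?_ hc
    have hg : 0 ≤ geomDiff K₁ K₂ := Real.sqrt_nonneg _
    rw [← Real.sqrt_sq hg, ← Real.sqrt_mul (sq_nonneg _), ← mul_div_assoc]
    exact Real.sqrt_le_sqrt (div_le_div_of_nonneg_right key (Nat.cast_nonneg N))
  · rintro 𝕜 _ N K₁ K₂ h₁ h₂ _ ⟨c, rfl⟩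
    exact ⟨_, tendsto_modelComplexityReg h₂ c, modelComplexity_mulVec_le h₂ c⟩
  · intro δ₀ hδ₀
    obtain ⟨C, hC, h⟩ := exists_predictionError_constant hδ₀
    refine ⟨C, hC, ?_⟩
    intro X _ D _ H _ _ φ m ψ O U N δ hφ hψ hψ1 hO hO1 hU hN hδ hle
    -- The unregularised bound is the case `l = 0`: the training coefficient vanishes, and positive
    -- definiteness supplies the invertibility that `l > 0` would otherwise give.
    refine (measure_mono ?_).trans
      (h X D H φ m ψ O U N 0 δ hφ hψ hψ1 hO hO1 hU hN le_rfl hδ hle)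
    rintro x ⟨hK, hx⟩
    rw [Set.mem_ofPred_eq, ridge_zero, geomDiffTra_zero, geomDiffGen_zero hK, zero_add]
    exact ⟨isUnit_det_of_posDef hK, hx⟩
  · intro 𝕜 _ N K₁ K₂ h₁ h₂
    refine ⟨fun l hl y => ?_, fun h => ⟨geomDiffGen_zero h K₂, geomDiffTra_zero K₁ K₂⟩⟩
    have hu := isUnit_det_of_posDef (ridge_posDef h₁ hl)
    obtain ⟨c, rfl⟩ := exists_mulVec_eq h₂ y
    rw [modelComplexity_mulVec h₂]
    exact ⟨modelComplexityReg_mulVec_le h₁ h₂.posSemidef hu c,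
      trainingError_mulVec_le h₁ h₂.posSemidef hu c⟩
  · intro X H₁ _ _ H₂ _ _ φ₁ φ₂ N x l w hl
    refine ⟨isMinOn_ridgeLoss_trainedWeight φ₂ hl x _, fun v hv => ?_⟩
    have hu := isUnit_det_of_posDef (ridge_posDef (kernelMatrix_posSemidef φ₂ x) hl)
    rw [eq_trainedWeight_of_isMinOn φ₂ hl x _ hv]
    refine ⟨norm_trainedWeight_sq_le φ₁ φ₂ x w hu, ?_⟩
    refine le_trans ?_ (sum_residual_trainedWeight_sq_le φ₁ φ₂ x w hu)
    exact mul_le_of_le_one_left (Finset.sum_nonneg fun _ _ => sq_nonneg _)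
      (by rw [one_div]; exact Nat.cast_inv_le_one N)
  · intro δ₀ hδ₀
    obtain ⟨C, hC, h⟩ := exists_predictionError_constant hδ₀
    refine ⟨C, hC, ?_⟩
    intro X _ D _ H _ _ φ m ψ O U N l δ hφ hψ hψ1 hO hO1 hU hN hl hδ hle
    refine (measure_mono ?_).trans
      (h X D H φ m ψ O U N l δ hφ hψ hψ1 hO hO1 hU hN hl.le hδ hle)
    intro x hx
    exact ⟨isUnit_det_of_posDef (ridge_posDef (kernelMatrix_posSemidef _ x) hl), hx⟩
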